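/- Let $a<b$, let $a\le x_1<\dots<x_n\le b$ be design points, and let $y\in\mathbb{R}^n$. Let $\mathbb{W}^2_n=\mathrm{diag}\big((x_3-x_1)/2,\dots,(x_n-x_{n-2})/2\big)$, and let $\mathbb{K}^2_n\in\mathbb{R}^{(n-2)\times(n-2)}$ be the inverse of the symmetric tridiagonal matrix with entries $$(\mathbb{K}^2_n)^{-1}_{ii}=\frac{4}{3(x_{i+2}-x_i)},\qquad (\mathbb{K}^2_n)^{-1}_{i,i-1}=(\mathbb{K}^2_n)^{-1}_{i-1,i}=\frac{2(x_{i+1}-x_i)}{3(x_{i+2}-x_i)(x_{i+1}-x_{i-1})}$$ (this tridiagonal matrix is invertible). Then $\mathbb{K}^2_n$ and $\mathbb{W}^2_n$ are $(3,1)$-spectrally similar, that is, both are positive semidefinite and $$u^{\mathsf T}\mathbb{W}^2_n u\le u^{\mathsf T}\mathbb{K}^2_n u\le 3\,u^{\mathsf T}\mathbb{W}^2_n u\quad\text{for all } u\in\mathbb{R}^{n-2}.$$ Consequently, let $\lambda_a\ge 0$ and $\lambda_b\ge 3\lambda_a$. Let $\hat f$ be a solution of the cubic smoothing spline problem with parameter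 $\lambda_a$, that is, a minimizer of $$\sum_{i=1}^n\big(y_i-f(x_i)\big)^2+\lambda_a\int_a^b (D^2f)(x)^2\,dx$$ over the Sobolev space $\mathcal{W}^{2,2}([a,b])$ of (continuous) functions $f$ on $[a,b]$ whose weak derivatives up to order two are square integrable; and let $\hat\theta$ be the weighted cubic Bohlmann-Whittaker (BW) filter with parameter $\lambda_b$, that is, the minimizer over $\theta\in\mathbb{R}^n$ of $$\|y-\theta\|_2^2+\lambda_b\big\|(\mathbb{W}^2_n)^{1/2}\mathbb{D}^2_n\theta\big\|_2^2=\|y-\theta\|_2^2+\lambda_b\sum_{i=1}^{n-2}(\mathbb{D}^2_n\theta)_i^2\cdot\frac{x_{i+2}-x_i}{2},$$ where $\mathbb{D}^2_n\in\mathbb{R}^{(n-2)\times n}$ is the second order discrete derivative matrix, given by $$(\mathbb{D}^2_n\theta)_i=\frac{2}{x_{i+2}-x_i}\Big(\frac{\theta_{i+2}-\theta_{i+1}}{x_{i+2}-x_{i+1}}-\frac{\theta_{i+1}-\theta_i}{x_{i+1}-x_i}\Big).$$ Then $$\sum_{i=1}^n\big(\hat f(x_i)-\hat\theta_i\big)^2\le\frac{\lambda_b}{3}\int_a^b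 (D^2\hat f)(x)^2\,dx.$$ -/

import Mathlib

open scoped ContDiff

noncomputable section

namespace SmoothingSpline

open MeasureTheory

/-! ### Weak derivatives and the `L²` Sobolev space on a bounded interval -/

/-- `g` is a `k`-th weak derivative of `f` on the open interval `(a, b)`. -/
def IsWeakDeriv (a b : ℝ) (k : ℕ) (f g : ℝ → ℝ) : Prop :=
  LocallyIntegrableOn f (Set.Ioo a b) ∧ LocallyIntegrableOn g (Set.Ioo a b) ∧
    ∀ φ : ℝ → ℝ, ContDiff ℝ ∞ φ → HasCompactSupport φ → tsupport φ ⊆ Set.Ioo a b →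
      ∫ t in Set.Ioo a b, f t * iteratedDeriv k φ t =
        (-1 : ℝ) ^ k * ∫ t in Set.Ioo a b, g t * φ t

open Classical in
/-- The `k`-th weak derivative `D^k f` on `(a, b)`. It is determined up to a null set; the value
is `0` if `f` has no `k`-th weak derivative. -/
def weakDeriv (a b : ℝ) (k : ℕ) (f : ℝ → ℝ) : ℝ → ℝ :=
  if h : ∃ g : ℝ → ℝ, IsWeakDeriv a b k f g then h.choose else 0

/-- Membership in `W^{m,2}([a, b])`, for `m ≥ 1`: all weak derivatives of order at most `m` exist
and are square integrable on `(a, b)`. As usual when point evaluations are used, an element is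
identified with its continuous representative on `[a, b]`. The values of `f` outside `[a, b]`
play no role. -/
def MemSobolev (a b : ℝ) (m : ℕ) (f : ℝ → ℝ) : Prop :=
  ContinuousOn f (Set.Icc a b) ∧
    ∀ k ≤ m, ∃ g : ℝ → ℝ,
      IsWeakDeriv a b k f g ∧ MemLp g 2 (volume.restrict (Set.Ioo a b))

/-- The criterion `∑ᵢ (yᵢ - f(xᵢ))² + lam ∫_a^b (D^m f)²`. -/
def splineObjective {n : ℕ} (a b : ℝ) (x y : Fin n → ℝ) (m : ℕ) (lam : ℝ) (f : ℝ → ℝ) : ℝ :=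
  ∑ i, (y i - f (x i)) ^ 2 + lam * ∫ t in a..b, weakDeriv a b m f t ^ 2

/-- `f` solves the smoothing spline problem of degree `2 m - 1` with tuning parameter `lam`: it
minimizes the criterion over `W^{m,2}([a, b])`. -/
def IsSmoothingSpline {n : ℕ} (a b : ℝ) (x y : Fin n → ℝ) (m : ℕ) (lam : ℝ) (f : ℝ → ℝ) : Prop :=
  MemSobolev a b m f ∧
    ∀ g : ℝ → ℝ, MemSobolev a b m g →
      splineObjective a b x y m lam f ≤ splineObjective a b x y m lam g

/-! ### Discrete derivatives (indices start at `0`) -/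

/-- The simple difference matrix, with rows `(…, 0, -1, 1, 0, …)`; used with `p + 1 = q`. -/
def diffMat (p q : ℕ) : Matrix (Fin p) (Fin q) ℝ :=
  Matrix.of fun i j =>
    if (j : ℕ) = i then -1 else if (j : ℕ) = i + 1 then 1 else 0

/-- The weights `(x_{i+k} - x_i) / k`, for `k ≥ 1`. -/
def weight {n : ℕ} (x : Fin n → ℝ) (k : ℕ) (i : Fin (n - k)) : ℝ :=
  (x ⟨i + k, by omega⟩ - x ⟨i, by omega⟩) / k

/-- The diagonal weight matrix `W^k_n`. -/
def weightMat {n : ℕ} (x : Fin n → ℝ) (k : ℕ) : Matrix (Fin (n - k)) (Fin (n - k)) ℝ :=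
  Matrix.diagonal (weight x k)

/-- The `k`-th order discrete derivative matrix `D^k_n`. -/
def discDeriv {n : ℕ} (x : Fin n → ℝ) : (k : ℕ) → Matrix (Fin (n - k)) (Fin n) ℝ
  | 0 => 1
  | k + 1 => (weightMat x (k + 1))⁻¹ * diffMat (n - (k + 1)) (n - k) * discDeriv x k

/-- The criterion `‖y - θ‖² + lam ‖(W^m_n)^{1/2} D^m_n θ‖²`. -/
def bwObjective {n : ℕ} (x y : Fin n → ℝ) (m : ℕ) (lam : ℝ) (θ : Fin n → ℝ) : ℝ :=
  ∑ i, (y i - θ i) ^ 2 + lam * ∑ i, ((discDeriv x m).mulVec θ i) ^ 2 * weight x m i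

/-- `θ` solves the weighted Bohlmann-Whittaker problem of order `m` with tuning parameter `lam`. -/
def IsWeightedBW {n : ℕ} (x y : Fin n → ℝ) (m : ℕ) (lam : ℝ) (θ : Fin n → ℝ) : Prop :=
  ∀ η : Fin n → ℝ, bwObjective x y m lam θ ≤ bwObjective x y m lam η

/-! ### The smoothing spline matrix for `m = 2` -/

/-- The symmetric tridiagonal matrix `(K^2_n)⁻¹`, with diagonal entries `4 / (3 (x_{i+2} - x_i))`
and entries `2 (x_{i+1} - x_i) / (3 (x_{i+2} - x_i) (x_{i+1} - x_{i-1}))` at `(i, i - 1)`. -/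
def kInv {n : ℕ} (x : Fin n → ℝ) : Matrix (Fin (n - 2)) (Fin (n - 2)) ℝ :=
  Matrix.of fun i j =>
    if (i : ℕ) = j then
      4 / (3 * (x ⟨i + 2, by omega⟩ - x ⟨i, by omega⟩))
    else if (i : ℕ) = j + 1 then
      2 * (x ⟨i + 1, by omega⟩ - x ⟨i, by omega⟩) /
        (3 * (x ⟨i + 2, by omega⟩ - x ⟨i, by omega⟩) * (x ⟨j + 2, by omega⟩ - x ⟨j, by omega⟩))
    else if (j : ℕ) = i + 1 then
      2 * (x ⟨j + 1, by omega⟩ - x ⟨j, by omega⟩) /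
        (3 * (x ⟨j + 2, by omega⟩ - x ⟨j, by omega⟩) * (x ⟨i + 2, by omega⟩ - x ⟨i, by omega⟩))
    else 0

/-- The matrix `K^2_n`. -/
def kMat {n : ℕ} (x : Fin n → ℝ) : Matrix (Fin (n - 2)) (Fin (n - 2)) ℝ :=
  (kInv x)⁻¹

/-- Positive semidefinite `A`, `B` are `(σ, τ)`-spectrally similar, where `0 < τ ≤ 1 ≤ σ`. -/
def SpectrallySimilar {p : ℕ} (σ τ : ℝ) (A B : Matrix (Fin p) (Fin p) ℝ) : Prop :=
  A.PosSemidef ∧ B.PosSemidef ∧ 0 < τ ∧ τ ≤ 1 ∧ 1 ≤ σ ∧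
    ∀ u : Fin p → ℝ,
      τ * (u ⬝ᵥ B.mulVec u) ≤ u ⬝ᵥ A.mulVec u ∧ u ⬝ᵥ A.mulVec u ≤ σ * (u ⬝ᵥ B.mulVec u)

end SmoothingSpline

end

noncomputable section

namespace SmoothingSpline

open MeasureTheory

/-! ### The Gram matrix of the hat functions and spectral similarity -/

/-! Write `T` for the Gram matrix in `L²` of the hat functions at the interior design points
(`hatGram`) and `W` for `weightMat x 2`. Then `kInv x` is `W⁻¹ T W⁻¹`, so `kMat x` is `W T⁻¹ W`. The
matrix `T` has nonnegative entries, diagonal `(2/3) W` and row sums at most `W`, so a Gershgorin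
argument gives `W/3 ≤ T ≤ W` as quadratic forms. Inverting yields `W ≤ K ≤ 3W`
(`spectrallySimilar_kMat`).

The link to splines is that the slope differences of `f` at the design points are the integrals of
`D²f` against the hat functions (`slopeDiff_eq_integral_hatAt_mul`). This has two consequences.
Every `θ` has an interpolant whose energy is the `K`-form of its discrete derivative `β`
(`exists_interpolant`). The energy `I` of any Sobolev function is at least the `W`-form of the
discrete derivative `γ` of its design values (`sum_weight_discDeriv_sq_le_integral`).

For the final bound, the spline's optimality is tested against the interpolant `F` of `θ`, and the
filter's optimality against the values of `f`. The sum of the two inequalities has the squared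
distance on the left. On the right, with `P` the `W`-product of `β` and `γ` and `Q` the `W`-form of
`β`, the energy of `F` is at most `3Q`, which leaves `lamB (P - Q) + (lamA / 2)(3Q - I)`. A weighted
AM-GM bound on `P` removes `Q`, and `3 lamA ≤ lamB` bounds the remaining coefficient of `I` by `lamB
/ 3`. -/

/-- The second divided difference of `v` at the design points, without the factor
`2 / (x_{i+2} - x_i)`. -/
def slopeDiff {n : ℕ} (x v : Fin n → ℝ) (i : Fin (n - 2)) : ℝ :=
  (v ⟨i + 2, by omega⟩ - v ⟨i + 1, by omega⟩) / (x ⟨i + 2, by omega⟩ - x ⟨i + 1, by omega⟩) -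
    (v ⟨i + 1, by omega⟩ - v ⟨i, by omega⟩) / (x ⟨i + 1, by omega⟩ - x ⟨i, by omega⟩)

/-- The Gram matrix of the hat functions at the interior design points. -/
def hatGram {n : ℕ} (x : Fin n → ℝ) : Matrix (Fin (n - 2)) (Fin (n - 2)) ℝ :=
  Matrix.of fun i j =>
    if (i : ℕ) = j then (x ⟨i + 2, by omega⟩ - x ⟨i, by omega⟩) / 3
    else if (i : ℕ) = j + 1 then (x ⟨i + 1, by omega⟩ - x ⟨i, by omega⟩) / 6
    else if (j : ℕ) = i + 1 then (x ⟨j + 1, by omega⟩ - x ⟨j, by omega⟩) / 6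
    else 0

theorem weight_pos {n : ℕ} {x : Fin n → ℝ} (hx : StrictMono x) {k : ℕ} (hk : 0 < k)
    (i : Fin (n - k)) : 0 < weight x k i := by
  have h : x ⟨i, by omega⟩ < x ⟨i + k, by omega⟩ := hx (Fin.mk_lt_mk.2 (by omega))
  exact div_pos (sub_pos.2 h) (by exact_mod_cast hk)

theorem weightMat_inv_mulVec {n : ℕ} {x : Fin n → ℝ} (hx : StrictMono x) {k : ℕ} (hk : 0 < k)
    (u : Fin (n - k) → ℝ) (i : Fin (n - k)) :
    (weightMat x k)⁻¹.mulVec u i = u i / weight x k i := by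
  have h : (weightMat x k)⁻¹ = Matrix.diagonal fun i => (weight x k i)⁻¹ := by
    refine Matrix.inv_eq_right_inv ?_
    rw [weightMat, Matrix.diagonal_mul_diagonal, ← Matrix.diagonal_one]
    congr 1
    ext i
    exact mul_inv_cancel₀ (weight_pos hx hk i).ne'
  rw [h, Matrix.mulVec_diagonal]
  ring

theorem diffMat_mulVec {p q : ℕ} (h : p + 1 = q) (u : Fin q → ℝ) (i : Fin p) :
    (diffMat p q).mulVec u i = u ⟨i + 1, by omega⟩ - u ⟨i, by omega⟩ := by
  subst h
  have key : ∀ j : Fin (p + 1), diffMat p (p + 1) i j * u j =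
      (if j = i.succ then u j else 0) - (if j = i.castSucc then u j else 0) := by
    intro j
    simp only [diffMat, Matrix.of_apply, Fin.ext_iff, Fin.val_succ, Fin.val_castSucc]
    split_ifs <;> first | omega | simp
  simp only [Matrix.mulVec, dotProduct, key, Finset.sum_sub_distrib, Finset.sum_ite_eq',
    Finset.mem_univ, if_true]
  rfl

/-- The outer factor of the recursive definition is the inverse weight, so multiplying by the weight
leaves a plain difference of first-order slopes. This is the form that integrals against hat
functions produce. -/
theorem weight_mul_discDeriv_two {n : ℕ} {x : Fin n → ℝ} (hx : StrictMono x) (v : Fin n → ℝ)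
    (i : Fin (n - 2)) : weight x 2 i * (discDeriv x 2).mulVec v i = slopeDiff x v i := by
  have h1 : ∀ j : Fin (n - 1), (discDeriv x 1).mulVec v j =
      (v ⟨j + 1, by omega⟩ - v ⟨j, by omega⟩) / (x ⟨j + 1, by omega⟩ - x ⟨j, by omega⟩) := by
    intro j
    have : discDeriv x 1 = (weightMat x 1)⁻¹ * diffMat (n - 1) n := by
      simp only [discDeriv]
      exact Matrix.mul_one _
    -- With truncated subtraction, `n - 1 + 1 = n` needs `0 < n`; the index `j` supplies it.
    rw [this, ← Matrix.mulVec_mulVec, weightMat_inv_mulVec hx one_pos,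
      diffMat_mulVec (by have := j.2; omega)]
    simp [weight]
  have h2 : discDeriv x 2 =
      (weightMat x 2)⁻¹ * diffMat (n - 2) (n - 1) * discDeriv x 1 := rfl
  rw [h2, ← Matrix.mulVec_mulVec, ← Matrix.mulVec_mulVec, weightMat_inv_mulVec hx two_pos,
    mul_div_cancel₀ _ (weight_pos hx two_pos i).ne', diffMat_mulVec (by have := i.2; omega),
    h1, h1]
  rfl

theorem kInv_apply {n : ℕ} {x : Fin n → ℝ} (hx : StrictMono x) (i j : Fin (n - 2)) :
    kInv x i j = hatGram x i j / (weight x 2 i * weight x 2 j) := by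
  have h : ∀ i : Fin (n - 2), x ⟨i + 2, by omega⟩ - x ⟨i, by omega⟩ ≠ 0 := fun i =>
    (sub_pos.2 (hx (Fin.mk_lt_mk.2 (by omega)))).ne'
  have hi := h i
  have hj := h j
  by_cases hij : (i : ℕ) = j
  · obtain rfl : i = j := Fin.ext hij
    simp only [kInv, hatGram, weight, Matrix.of_apply, if_true]
    push_cast
    field_simp
    ring
  · simp only [kInv, hatGram, weight, Matrix.of_apply, if_neg hij]
    push_cast
    split_ifs
    · field_simp
      ring
    · field_simp
      ring
    · simp

theorem hatGram_symm {n : ℕ} (x : Fin n → ℝ) (i j : Fin (n - 2)) :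
    hatGram x i j = hatGram x j i := by
  by_cases hij : (i : ℕ) = j
  · obtain rfl : i = j := Fin.ext hij
    rfl
  · simp only [hatGram, Matrix.of_apply, if_neg hij, if_neg (Ne.symm hij)]
    split_ifs <;> first | omega | rfl

theorem hatGram_nonneg {n : ℕ} {x : Fin n → ℝ} (hx : StrictMono x) (i j : Fin (n - 2)) :
    0 ≤ hatGram x i j := by
  have h : ∀ {p q : ℕ} (hp : p < n) (hq : q < n), p ≤ q → 0 ≤ x ⟨q, hq⟩ - x ⟨p, hp⟩ :=
    fun hp hq hpq => sub_nonneg.2 (hx.monotone (Fin.mk_le_mk.2 hpq))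
  simp only [hatGram, Matrix.of_apply]
  split_ifs
  · exact div_nonneg (h _ _ (by omega)) (by norm_num)
  · exact div_nonneg (h _ _ (by omega)) (by norm_num)
  · exact div_nonneg (h _ _ (by omega)) (by norm_num)
  · exact le_rfl

/-! ### Gershgorin-type bounds for the Gram matrix -/

theorem sum_ite_le_of_subsingleton {ι : Type*} [Fintype ι] (P : ι → Prop) [DecidablePred P]
    (hP : ∀ i j, P i → P j → i = j) {c : ℝ} (hc : 0 ≤ c) :
    ∑ i, (if P i then c else 0) ≤ c := by
  rw [← Finset.sum_filter, Finset.sum_const, nsmul_eq_mul]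
  have : (Finset.univ.filter P).card ≤ 1 := Finset.card_le_one.2 fun i hi j hj =>
    hP i j (by simpa using hi) (by simpa using hj)
  exact mul_le_of_le_one_left hc (by exact_mod_cast this)

/-- Rows with both neighbours attain equality: the two off-diagonal sixths add up to one sixth of
`x_{i+2} - x_i`. The first and last rows lack a neighbour, hence only an inequality. -/
theorem sum_hatGram_le {n : ℕ} {x : Fin n → ℝ} (hx : StrictMono x) (i : Fin (n - 2)) :
    ∑ j, hatGram x i j ≤ weight x 2 i := by
  have h : ∀ {p q : ℕ} (hp : p < n) (hq : q < n), p ≤ q → 0 ≤ x ⟨q, hq⟩ - x ⟨p, hp⟩ :=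
    fun hp hq hpq => sub_nonneg.2 (hx.monotone (Fin.mk_le_mk.2 hpq))
  have hA : 0 ≤ (x ⟨i + 2, by omega⟩ - x ⟨i, by omega⟩) / 3 :=
    div_nonneg (h _ _ (by omega)) (by norm_num)
  have hB : 0 ≤ (x ⟨i + 1, by omega⟩ - x ⟨i, by omega⟩) / 6 :=
    div_nonneg (h _ _ (by omega)) (by norm_num)
  have hC : 0 ≤ (x ⟨i + 2, by omega⟩ - x ⟨i + 1, by omega⟩) / 6 :=
    div_nonneg (h _ _ (by omega)) (by norm_num)
  have key : ∀ j : Fin (n - 2), hatGram x i j =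
      (if (i : ℕ) = j then (x ⟨i + 2, by omega⟩ - x ⟨i, by omega⟩) / 3 else 0) +
      (if (i : ℕ) = j + 1 then (x ⟨i + 1, by omega⟩ - x ⟨i, by omega⟩) / 6 else 0) +
      (if (j : ℕ) = i + 1 then (x ⟨i + 2, by omega⟩ - x ⟨i + 1, by omega⟩) / 6 else 0) := by
    intro j
    simp only [hatGram, Matrix.of_apply]
    split_ifs with h1 h2 h3 h4 h5 <;> first | omega | simp_all
  rw [Finset.sum_congr rfl fun j _ => key j, Finset.sum_add_distrib, Finset.sum_add_distrib]
  have e1 := sum_ite_le_of_subsingleton (fun j : Fin (n - 2) => (i : ℕ) = j)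
    (fun p q hp hq => Fin.ext (by omega)) hA
  have e2 := sum_ite_le_of_subsingleton (fun j : Fin (n - 2) => (i : ℕ) = j + 1)
    (fun p q hp hq => Fin.ext (by omega)) hB
  have e3 := sum_ite_le_of_subsingleton (fun j : Fin (n - 2) => (j : ℕ) = i + 1)
    (fun p q hp hq => Fin.ext (by omega)) hC
  simp only [weight]
  push_cast
  linarith

/-- Expand the nonnegative sum of `A i j * (z i - z j) ^ 2` and use symmetry. -/
theorem quadForm_le_of_nonneg {ι : Type*} [Fintype ι] {A : ι → ι → ℝ} (hA : ∀ i j, 0 ≤ A i j)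
    (hs : ∀ i j, A i j = A j i) (z : ι → ℝ) :
    ∑ i, ∑ j, A i j * (z i * z j) ≤ ∑ i, (∑ j, A i j) * z i ^ 2 := by
  have h : 0 ≤ ∑ i, ∑ j, A i j * (z i - z j) ^ 2 :=
    Finset.sum_nonneg fun i _ => Finset.sum_nonneg fun j _ => mul_nonneg (hA i j) (sq_nonneg _)
  have e : ∑ i, ∑ j, A i j * (z i - z j) ^ 2 = ∑ i, ∑ j, A i j * z i ^ 2 +
      ∑ i, ∑ j, A i j * z j ^ 2 - 2 * ∑ i, ∑ j, A i j * (z i * z j) := by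
    simp only [Finset.mul_sum, ← Finset.sum_add_distrib, ← Finset.sum_sub_distrib]
    exact Finset.sum_congr rfl fun i _ => Finset.sum_congr rfl fun j _ => by ring
  have s : ∑ i, ∑ j, A i j * z j ^ 2 = ∑ i, ∑ j, A i j * z i ^ 2 := by
    rw [Finset.sum_comm]
    exact Finset.sum_congr rfl fun i _ => Finset.sum_congr rfl fun j _ => by rw [hs]
  simp only [Finset.sum_mul]
  linarith

/-- Expand the sum of `A i j * (z i + z j) ^ 2`, which is at least its diagonal part, the sum of `4
* A i i * z i ^ 2`. -/
theorem le_quadForm_of_nonneg {ι : Type*} [Fintype ι] {A : ι → ι → ℝ} (hA : ∀ i j, 0 ≤ A i j)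
    (hs : ∀ i j, A i j = A j i) (z : ι → ℝ) :
    ∑ i, (2 * A i i - ∑ j, A i j) * z i ^ 2 ≤ ∑ i, ∑ j, A i j * (z i * z j) := by
  have h : ∑ i, 4 * (A i i * z i ^ 2) ≤ ∑ i, ∑ j, A i j * (z i + z j) ^ 2 := by
    refine Finset.sum_le_sum fun i _ => ?_
    refine le_trans (le_of_eq ?_) (Finset.single_le_sum (f := fun j => A i j * (z i + z j) ^ 2)
      (fun j _ => mul_nonneg (hA i j) (sq_nonneg _)) (Finset.mem_univ i))
    ring
  have e : ∑ i, ∑ j, A i j * (z i + z j) ^ 2 = ∑ i, ∑ j, A i j * z i ^ 2 +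
      ∑ i, ∑ j, A i j * z j ^ 2 + 2 * ∑ i, ∑ j, A i j * (z i * z j) := by
    simp only [Finset.mul_sum, ← Finset.sum_add_distrib]
    exact Finset.sum_congr rfl fun i _ => Finset.sum_congr rfl fun j _ => by ring
  have s : ∑ i, ∑ j, A i j * z j ^ 2 = ∑ i, ∑ j, A i j * z i ^ 2 := by
    rw [Finset.sum_comm]
    exact Finset.sum_congr rfl fun i _ => Finset.sum_congr rfl fun j _ => by rw [hs]
  simp only [sub_mul, Finset.sum_sub_distrib, Finset.sum_mul]
  rw [← Finset.mul_sum] at h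
  have : ∑ i, 2 * A i i * z i ^ 2 = 2 * ∑ i, A i i * z i ^ 2 := by
    rw [Finset.mul_sum]
    exact Finset.sum_congr rfl fun i _ => by ring
  linarith

theorem hatGram_quadForm_le {n : ℕ} {x : Fin n → ℝ} (hx : StrictMono x) (z : Fin (n - 2) → ℝ) :
    ∑ i, ∑ j, hatGram x i j * (z i * z j) ≤ ∑ i, weight x 2 i * z i ^ 2 :=
  (quadForm_le_of_nonneg (hatGram_nonneg hx) (hatGram_symm x) z).trans
    (Finset.sum_le_sum fun i _ => mul_le_mul_of_nonneg_right (sum_hatGram_le hx i) (sq_nonneg _))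

/-- The diagonal is two thirds of the weight and the row sum at most the weight, so twice the
diagonal minus the row sum is at least `4/3 - 1 = 1/3` of the weight. -/
theorem le_hatGram_quadForm {n : ℕ} {x : Fin n → ℝ} (hx : StrictMono x) (z : Fin (n - 2) → ℝ) :
    ∑ i, weight x 2 i * z i ^ 2 ≤ 3 * ∑ i, ∑ j, hatGram x i j * (z i * z j) := by
  refine le_trans ?_ (mul_le_mul_of_nonneg_left
    (le_quadForm_of_nonneg (hatGram_nonneg hx) (hatGram_symm x) z) (by norm_num))
  rw [Finset.mul_sum]
  refine Finset.sum_le_sum fun i _ => ?_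
  have h := sum_hatGram_le hx i
  have hd : hatGram x i i = 2 / 3 * weight x 2 i := by
    simp only [hatGram, weight, Matrix.of_apply, if_true]
    push_cast
    ring
  rw [← mul_assoc]
  exact mul_le_mul_of_nonneg_right (by linarith) (sq_nonneg _)

/-! ### Passing from the Gram matrix to its inverse -/

theorem kInv_mulVec {n : ℕ} {x : Fin n → ℝ} (hx : StrictMono x) (u : Fin (n - 2) → ℝ)
    (i : Fin (n - 2)) : weight x 2 i * (kInv x).mulVec u i =
      ∑ j, hatGram x i j * (u j / weight x 2 j) := by
  simp only [Matrix.mulVec, dotProduct, Finset.mul_sum, kInv_apply hx]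
  refine Finset.sum_congr rfl fun j _ => ?_
  have := (weight_pos hx two_pos i).ne'
  field_simp

theorem dotProduct_kInv_mulVec {n : ℕ} {x : Fin n → ℝ} (hx : StrictMono x)
    (u : Fin (n - 2) → ℝ) : u ⬝ᵥ (kInv x).mulVec u =
      ∑ i, ∑ j, hatGram x i j * (u i / weight x 2 i * (u j / weight x 2 j)) := by
  simp only [dotProduct]
  refine Finset.sum_congr rfl fun i _ => ?_
  have h := (weight_pos hx two_pos i).ne'
  have : u i * (kInv x).mulVec u i =
      u i / weight x 2 i * (weight x 2 i * (kInv x).mulVec u i) := by field_simp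
  rw [this, kInv_mulVec hx, Finset.mul_sum]
  exact Finset.sum_congr rfl fun j _ => by ring

theorem kInv_posDef {n : ℕ} {x : Fin n → ℝ} (hx : StrictMono x) : (kInv x).PosDef := by
  refine Matrix.PosDef.of_dotProduct_mulVec_pos ?_ ?_
  · ext i j
    simp [kInv_apply hx, hatGram_symm x i j, mul_comm]
  · intro u hu
    have h := le_hatGram_quadForm hx fun i => u i / weight x 2 i
    rw [← dotProduct_kInv_mulVec hx] at h
    obtain ⟨i, hi⟩ := Function.ne_iff.1 hu
    have : 0 < ∑ i, weight x 2 i * (u i / weight x 2 i) ^ 2 :=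
      Finset.sum_pos' (fun i _ => mul_nonneg (weight_pos hx two_pos i).le (sq_nonneg _))
        ⟨i, Finset.mem_univ i, mul_pos (weight_pos hx two_pos i)
          (sq_pos_of_ne_zero (div_ne_zero hi (weight_pos hx two_pos i).ne'))⟩
    simp only [star_trivial]
    linarith

theorem dotProduct_weightMat_mulVec {n : ℕ} (x : Fin n → ℝ) (u : Fin (n - 2) → ℝ) :
    u ⬝ᵥ (weightMat x 2).mulVec u = ∑ i, weight x 2 i * u i ^ 2 := by
  simp only [dotProduct, weightMat, Matrix.mulVec_diagonal]
  exact Finset.sum_congr rfl fun i _ => by ring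

theorem kInv_mulVec_kMat_mulVec {n : ℕ} {x : Fin n → ℝ} (hx : StrictMono x)
    (u : Fin (n - 2) → ℝ) : (kInv x).mulVec ((kMat x).mulVec u) = u := by
  rw [Matrix.mulVec_mulVec, kMat, Matrix.mul_nonsing_inv _
    ((Matrix.isUnit_iff_isUnit_det _).1 (kInv_posDef hx).isUnit), Matrix.one_mulVec]

/-- The coefficients of the second derivative of the natural spline in the hat function basis. -/
theorem hatGram_mulVec_kMat {n : ℕ} {x : Fin n → ℝ} (hx : StrictMono x)
    (u : Fin (n - 2) → ℝ) (i : Fin (n - 2)) :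
    ∑ j, hatGram x i j * ((kMat x).mulVec u j / weight x 2 j) = weight x 2 i * u i := by
  rw [← kInv_mulVec hx, kInv_mulVec_kMat_mulVec hx]

theorem dotProduct_kMat_mulVec {n : ℕ} {x : Fin n → ℝ} (hx : StrictMono x)
    (u : Fin (n - 2) → ℝ) : u ⬝ᵥ (kMat x).mulVec u =
      ∑ i, ∑ j, hatGram x i j *
        ((kMat x).mulVec u i / weight x 2 i * ((kMat x).mulVec u j / weight x 2 j)) := by
  rw [← dotProduct_kInv_mulVec hx, kInv_mulVec_kMat_mulVec hx, dotProduct_comm]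

theorem spectrallySimilar_kMat {n : ℕ} {x : Fin n → ℝ} (hx : StrictMono x) :
    SpectrallySimilar 3 1 (kMat x) (weightMat x 2) := by
  refine ⟨(kInv_posDef hx).inv.posSemidef,
    Matrix.PosSemidef.diagonal fun i => (weight_pos hx two_pos i).le, one_pos, le_rfl,
    by norm_num, fun u => ?_⟩
  -- Here `z = W⁻¹ K u = T⁻¹ W u`; the `K`-form of `u` is both the `T`-form of `z` and the
  -- `W`-product of `z` and `u`.
  set z : Fin (n - 2) → ℝ := fun i => (kMat x).mulVec u i / weight x 2 i with hz
  have hK : u ⬝ᵥ (kMat x).mulVec u = ∑ i, ∑ j, hatGram x i j * (z i * z j) :=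
    dotProduct_kMat_mulVec hx u
  have hT : ∀ i, ∑ j, hatGram x i j * z j = weight x 2 i * u i := hatGram_mulVec_kMat hx u
  have hzu : ∀ v : Fin (n - 2) → ℝ, ∑ i, ∑ j, hatGram x i j * (v i * z j) =
      ∑ i, weight x 2 i * (v i * u i) := by
    intro v
    refine Finset.sum_congr rfl fun i _ => ?_
    rw [mul_left_comm, ← hT, Finset.mul_sum]
    exact Finset.sum_congr rfl fun j _ => by ring
  rw [dotProduct_weightMat_mulVec, hK]
  constructor
  -- The `T`-form of `u - z` is nonnegative and equals `uᵀTu + uᵀKu - 2 uᵀWu`; then `T ≤ W` bounds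
  -- the first term.
  · have h0 := le_hatGram_quadForm hx fun i => u i - z i
    have h0' : 0 ≤ ∑ i, weight x 2 i * (u i - z i) ^ 2 :=
      Finset.sum_nonneg fun i _ => mul_nonneg (weight_pos hx two_pos i).le (sq_nonneg _)
    have h1 := hatGram_quadForm_le hx u
    have e : ∑ i, ∑ j, hatGram x i j * ((u i - z i) * (u j - z j)) =
        ∑ i, ∑ j, hatGram x i j * (u i * u j) + ∑ i, ∑ j, hatGram x i j * (z i * z j) -
        ∑ i, ∑ j, hatGram x i j * (u i * z j) - ∑ i, ∑ j, hatGram x i j * (z i * u j) := by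
      simp only [← Finset.sum_add_distrib, ← Finset.sum_sub_distrib]
      exact Finset.sum_congr rfl fun i _ => Finset.sum_congr rfl fun j _ => by ring
    have s : ∑ i, ∑ j, hatGram x i j * (z i * u j) = ∑ i, ∑ j, hatGram x i j * (u i * z j) := by
      rw [Finset.sum_comm]
      exact Finset.sum_congr rfl fun i _ => Finset.sum_congr rfl fun j _ => by
        rw [hatGram_symm]
        ring
    have q : ∑ i, weight x 2 i * (u i * u i) = ∑ i, weight x 2 i * u i ^ 2 :=
      Finset.sum_congr rfl fun i _ => by ring
    rw [s, hzu u, q] at e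
    linarith
  -- Here `zᵀWz ≤ 3 zᵀTz = 3 zᵀWu`. Inserted into the expansion of the `W`-form of `3u - z`, this
  -- gives `zᵀWu ≤ 3 uᵀWu`.
  · have h := le_hatGram_quadForm hx z
    have h0 : 0 ≤ ∑ i, weight x 2 i * (3 * u i - z i) ^ 2 :=
      Finset.sum_nonneg fun i _ => mul_nonneg (weight_pos hx two_pos i).le (sq_nonneg _)
    have e : ∑ i, weight x 2 i * (3 * u i - z i) ^ 2 = 9 * ∑ i, weight x 2 i * u i ^ 2 -
        6 * ∑ i, weight x 2 i * (z i * u i) + ∑ i, weight x 2 i * z i ^ 2 := by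
      simp only [Finset.mul_sum, ← Finset.sum_add_distrib, ← Finset.sum_sub_distrib]
      exact Finset.sum_congr rfl fun i _ => by ring
    rw [hzu] at h
    rw [hzu]
    linarith

/-! ### Test functions and weak derivatives -/

/-- Smooth functions with compact support in `(a, b)`. -/
def IsTestFun (a b : ℝ) (φ : ℝ → ℝ) : Prop :=
  ContDiff ℝ ∞ φ ∧ HasCompactSupport φ ∧ tsupport φ ⊆ Set.Ioo a b

namespace IsTestFun

variable {a b : ℝ} {φ ψ : ℝ → ℝ}

theorem deriv (h : IsTestFun a b φ) : IsTestFun a b (deriv φ) :=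
  ⟨(contDiff_infty_iff_deriv.1 h.1).2, h.2.1.deriv, tsupport_deriv_subset.trans h.2.2⟩

theorem hasDerivAt (h : IsTestFun a b φ) (t : ℝ) : HasDerivAt φ (_root_.deriv φ t) t :=
  ((contDiff_infty_iff_deriv.1 h.1).1 t).hasDerivAt

theorem iteratedDeriv (h : IsTestFun a b φ) (k : ℕ) : IsTestFun a b (iteratedDeriv k φ) := by
  induction k with
  | zero => simpa using h
  | succ k ih =>
    rw [iteratedDeriv_succ]
    exact ih.deriv

theorem continuous (h : IsTestFun a b φ) : Continuous φ := h.1.continuous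

theorem eq_zero (h : IsTestFun a b φ) {t : ℝ} (ht : t ∉ Set.Ioo a b) : φ t = 0 :=
  image_eq_zero_of_notMem_tsupport fun h' => ht (h.2.2 h')

theorem left_eq_zero (h : IsTestFun a b φ) : φ a = 0 := h.eq_zero (by simp)

theorem right_eq_zero (h : IsTestFun a b φ) : φ b = 0 := h.eq_zero (by simp)

theorem sub_const_mul (h : IsTestFun a b φ) (h' : IsTestFun a b ψ) (c : ℝ) :
    IsTestFun a b (fun t => φ t - c * ψ t) := by
  have hsupp : tsupport (fun t => φ t - c * ψ t) ⊆ tsupport φ ∪ tsupport ψ := by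
    refine closure_minimal (fun t ht => ?_) ((isClosed_tsupport φ).union (isClosed_tsupport ψ))
    by_contra hn
    rw [Set.mem_union, not_or] at hn
    refine ht ?_
    simp [image_eq_zero_of_notMem_tsupport hn.1, image_eq_zero_of_notMem_tsupport hn.2]
  refine ⟨h.1.sub (contDiff_const.mul h'.1), ?_, hsupp.trans (Set.union_subset h.2.2 h'.2.2)⟩
  exact (h.2.1.union h'.2.1).of_isClosed_subset (isClosed_tsupport _) hsupp

/-- Local integrability in the open interval suffices, because the support of `φ` is compact and
stays away from the endpoints. -/
theorem integrableOn_mul (h : IsTestFun a b φ) {g : ℝ → ℝ}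
    (hg : LocallyIntegrableOn g (Set.Ioo a b)) :
    IntegrableOn (fun t => g t * φ t) (Set.Ioo a b) := by
  have hK : IntegrableOn (fun t => g t * φ t) (tsupport φ) :=
    (hg.integrableOn_compact_subset h.2.2 h.2.1).mul_continuousOn h.continuous.continuousOn h.2.1
  refine hK.of_forall_sdiff_eq_zero measurableSet_Ioo fun t ht => ?_
  rw [image_eq_zero_of_notMem_tsupport ht.2, mul_zero]

theorem integrableOn (h : IsTestFun a b φ) : IntegrableOn φ (Set.Ioo a b) :=
  (h.continuous.integrable_of_hasCompactSupport h.2.1).integrableOn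

/-- A test function with zero mean is the derivative of a test function. -/
theorem exists_primitive (h : IsTestFun a b φ) (hab : a < b) (h0 : ∫ t in a..b, φ t = 0) :
    ∃ Φ, IsTestFun a b Φ ∧ _root_.deriv Φ = φ := by
  have hd : ∀ x, HasDerivAt (fun x => ∫ t in a..x, φ t) (φ x) x := fun x =>
    intervalIntegral.integral_hasDerivAt_right (h.continuous.intervalIntegrable _ _)
      h.continuous.stronglyMeasurable.stronglyMeasurableAtFilter h.continuous.continuousAt
  have hderiv : _root_.deriv (fun x => ∫ t in a..x, φ t) = φ := funext fun x => (hd x).deriv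
  obtain ⟨c, d, hac, hdb, hcd⟩ : ∃ c d, a < c ∧ d < b ∧ tsupport φ ⊆ Set.Icc c d := by
    rcases (tsupport φ).eq_empty_or_nonempty with he | hne
    -- If `φ` vanishes, the reversed endpoints make `Set.Icc c d` empty and keep both strict
    -- inequalities.
    · exact ⟨b, a, hab, hab, by simp [he]⟩
    · obtain ⟨c, hc⟩ := h.2.1.exists_isLeast hne
      obtain ⟨d, hd'⟩ := h.2.1.exists_isGreatest hne
      exact ⟨c, d, (h.2.2 hc.1).1, (h.2.2 hd'.1).2, fun t ht => ⟨hc.2 ht, hd'.2 ht⟩⟩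
  have hzero : ∀ t, t ∉ Set.Icc c d → φ t = 0 := fun t ht =>
    image_eq_zero_of_notMem_tsupport fun h' => ht (hcd h')
  have hsupp : tsupport (fun x => ∫ t in a..x, φ t) ⊆ Set.Icc c d := by
    refine closure_minimal (fun x hx => ?_) isClosed_Icc
    by_contra hn
    refine hx ?_
    rw [Set.mem_Icc, not_and_or, not_le, not_le] at hn
    rcases hn with hn | hn
    · refine intervalIntegral.integral_zero_ae (Filter.Eventually.of_forall fun t ht => ?_)
      refine hzero t fun hcon => ?_
      have := ht.2
      have h2 : max a x < c := max_lt hac hn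
      exact absurd hcon.1 (not_le.2 (this.trans_lt h2))
    -- To the right of the support the primitive is the full integral of `φ`; this is where zero
    -- mean is needed.
    · have hx' : ∫ t in b..x, φ t = 0 := by
        refine intervalIntegral.integral_zero_ae (Filter.Eventually.of_forall fun t ht => ?_)
        refine hzero t fun hcon => ?_
        have h2 : d < min b x := lt_min hdb hn
        exact absurd hcon.2 (not_le.2 (h2.trans ht.1))
      show ∫ t in a..x, φ t = 0
      rw [← intervalIntegral.integral_add_adjacent_intervals
        (h.continuous.intervalIntegrable a b) (h.continuous.intervalIntegrable b x), h0, hx',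
        add_zero]
  refine ⟨fun x => ∫ t in a..x, φ t, ⟨?_, ?_, ?_⟩, hderiv⟩
  · rw [contDiff_infty_iff_deriv, hderiv]
    exact ⟨fun x => (hd x).differentiableAt, h.1⟩
  · exact isCompact_Icc.of_isClosed_subset (isClosed_tsupport _) hsupp
  · exact hsupp.trans fun t ht => ⟨hac.trans_le ht.1, ht.2.trans_lt hdb⟩

end IsTestFun

theorem exists_isTestFun_integral_eq_one {a b : ℝ} (hab : a < b) :
    ∃ ψ, IsTestFun a b ψ ∧ ∫ t in a..b, ψ t = 1 := by
  have hr : 0 < (b - a) / 8 := by linarith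
  let f : ContDiffBump ((a + b) / 2) := ⟨(b - a) / 8, (b - a) / 4, hr, by linarith⟩
  have ht : tsupport (f.normed volume) ⊆ Set.Ioo a b := by
    rw [f.tsupport_normed_eq]
    intro t ht
    rw [Metric.mem_closedBall, Real.dist_eq, abs_le] at ht
    have : f.rOut = (b - a) / 4 := rfl
    constructor <;> linarith [ht.1, ht.2]
  refine ⟨f.normed volume, ⟨f.contDiff_normed, f.hasCompactSupport_normed, ht⟩, ?_⟩
  rw [intervalIntegral.integral_eq_integral_of_support_subset]
  · exact f.integral_normed
  · exact (subset_tsupport _).trans (ht.trans Set.Ioo_subset_Ioc_self)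

theorem intervalIntegral_eq_integral_Ioo {a b : ℝ} (hab : a ≤ b) (f : ℝ → ℝ) :
    ∫ t in a..b, f t = ∫ t in Set.Ioo a b, f t := by
  rw [intervalIntegral.integral_of_le hab, integral_Ioc_eq_integral_Ioo]

/-- The fundamental lemma of the calculus of variations, applied to `g - g'`. -/
theorem ae_eq_of_integral_mul_isTestFun {a b : ℝ} {g g' : ℝ → ℝ}
    (hg : LocallyIntegrableOn g (Set.Ioo a b)) (hg' : LocallyIntegrableOn g' (Set.Ioo a b))
    (h : ∀ φ, IsTestFun a b φ →
      ∫ t in Set.Ioo a b, g t * φ t = ∫ t in Set.Ioo a b, g' t * φ t) :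
    g =ᵐ[volume.restrict (Set.Ioo a b)] g' := by
  have := isOpen_Ioo.ae_eq_zero_of_integral_contDiff_smul_eq_zero (μ := volume) (hg.sub hg')
    fun φ h1 h2 h3 => ?_
  · rw [Filter.EventuallyEq, ae_restrict_iff' measurableSet_Ioo]
    filter_upwards [this] with t ht hts
    exact sub_eq_zero.1 (ht hts)
  · have hφ : IsTestFun a b φ := ⟨h1, h2, h3⟩
    rw [← setIntegral_eq_integral_of_forall_compl_eq_zero (s := Set.Ioo a b)
      fun t ht => by rw [hφ.eq_zero ht, zero_smul]]
    have e : ∀ t, φ t • (g - g') t = g t * φ t - g' t * φ t := fun t => by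
      simp only [smul_eq_mul, Pi.sub_apply]
      ring
    simp only [e]
    rw [integral_sub (hφ.integrableOn_mul hg) (hφ.integrableOn_mul hg'), h φ hφ, sub_self]

namespace IsWeakDeriv

variable {a b : ℝ} {k : ℕ} {f f' g g' : ℝ → ℝ}

theorem ae_eq (h : IsWeakDeriv a b k f g) (h' : IsWeakDeriv a b k f g') :
    g =ᵐ[volume.restrict (Set.Ioo a b)] g' := by
  refine ae_eq_of_integral_mul_isTestFun h.2.1 h'.2.1 fun φ hφ => ?_
  have e := (h.2.2 φ hφ.1 hφ.2.1 hφ.2.2).symm.trans (h'.2.2 φ hφ.1 hφ.2.1 hφ.2.2)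
  exact mul_left_cancel₀ (pow_ne_zero _ (by norm_num)) e

/-- Frees the energy from the arbitrary choice in `weakDeriv`: any weak derivative computes it, by
almost everywhere uniqueness. -/
theorem integral_weakDeriv_sq (hab : a < b) (h : IsWeakDeriv a b k f g) :
    ∫ t in a..b, weakDeriv a b k f t ^ 2 = ∫ t in Set.Ioo a b, g t ^ 2 := by
  have hex : ∃ g : ℝ → ℝ, IsWeakDeriv a b k f g := ⟨g, h⟩
  have hw : weakDeriv a b k f = hex.choose := dif_pos hex
  rw [intervalIntegral_eq_integral_Ioo hab.le, hw]
  refine integral_congr_ae ?_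
  filter_upwards [hex.choose_spec.ae_eq h] with t ht
  rw [ht]

theorem add_const_mul (h : IsWeakDeriv a b k f g) (h' : IsWeakDeriv a b k f' g') (c : ℝ) :
    IsWeakDeriv a b k (fun t => f t + c * f' t) (fun t => g t + c * g' t) := by
  refine ⟨h.1.add (h'.1.smul c), h.2.1.add (h'.2.1.smul c), fun φ h1 h2 h3 => ?_⟩
  have hφ : IsTestFun a b φ := ⟨h1, h2, h3⟩
  have e : ∀ (F G ψ : ℝ → ℝ) (t : ℝ), (F t + c * G t) * ψ t = F t * ψ t + c * (G t * ψ t) :=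
    fun F G ψ t => by ring
  have hI : ∀ {F G ψ : ℝ → ℝ}, IsTestFun a b ψ → LocallyIntegrableOn F (Set.Ioo a b) →
      LocallyIntegrableOn G (Set.Ioo a b) → ∫ t in Set.Ioo a b, (F t + c * G t) * ψ t =
        (∫ t in Set.Ioo a b, F t * ψ t) + c * ∫ t in Set.Ioo a b, G t * ψ t := by
    intro F G ψ hψ hF hG
    simp only [e F G ψ]
    rw [integral_add (hψ.integrableOn_mul hF) ((hψ.integrableOn_mul hG).const_mul c),
      integral_const_mul]
  rw [hI (hφ.iteratedDeriv k) h.1 h'.1, hI hφ h.2.1 h'.2.1, h.2.2 φ h1 h2 h3,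
    h'.2.2 φ h1 h2 h3]
  ring

end IsWeakDeriv

theorem MemSobolev.add_const_mul {a b : ℝ} {m : ℕ} {f f' : ℝ → ℝ} (h : MemSobolev a b m f)
    (h' : MemSobolev a b m f') (c : ℝ) : MemSobolev a b m (fun t => f t + c * f' t) := by
  refine ⟨h.1.add (h'.1.const_mul c), fun k hk => ?_⟩
  obtain ⟨g, hg, hg2⟩ := h.2 k hk
  obtain ⟨g', hg', hg2'⟩ := h'.2 k hk
  exact ⟨_, hg.add_const_mul hg' c, hg2.add (hg2'.const_mul c)⟩

/-- A continuous function with vanishing second weak derivative is affine. -/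
theorem exists_affine_of_integral_mul_deriv_deriv_eq_zero {a b : ℝ} (hab : a < b) {u : ℝ → ℝ}
    (hu : ContinuousOn u (Set.Icc a b))
    (h : ∀ φ, IsTestFun a b φ → ∫ t in Set.Ioo a b, u t * deriv (deriv φ) t = 0) :
    ∃ c₀ c₁, ∀ t ∈ Set.Icc a b, u t = c₀ + c₁ * t := by
  obtain ⟨ψ, hψ, hψ1⟩ := exists_isTestFun_integral_eq_one hab
  have hloc : ∀ {v : ℝ → ℝ}, ContinuousOn v (Set.Icc a b) →
      LocallyIntegrableOn v (Set.Ioo a b) := fun hv =>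
    (hv.mono Set.Ioo_subset_Icc_self).locallyIntegrableOn measurableSet_Ioo
  -- Subtracting a multiple of the unit-mass `ψ` gives zero mean. The du Bois-Reymond argument uses
  -- this twice, once for each derivative.
  have reduce : ∀ η, IsTestFun a b η →
      ∃ Φ, IsTestFun a b Φ ∧ deriv Φ = fun t => η t - (∫ s in a..b, η s) * ψ t := by
    intro η hη
    refine (hη.sub_const_mul hψ _).exists_primitive hab ?_
    rw [intervalIntegral.integral_sub (hη.continuous.intervalIntegrable _ _)
      ((hψ.continuous.intervalIntegrable _ _).const_mul _), intervalIntegral.integral_const_mul,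
      hψ1, mul_one, sub_self]
  -- The slope of `u` will be `-κ`: testing with `Φ` gives `∫ u η' = κ ∫ η`, while `∫ t η' = -∫ η`,
  -- so `u + κ t` has zero weak derivative.
  set κ := ∫ t in Set.Ioo a b, u t * deriv ψ t with hκ
  set v : ℝ → ℝ := fun t => u t + κ * t with hv
  have hvc : ContinuousOn v (Set.Icc a b) := hu.add (by fun_prop)
  have hv0 : ∀ η, IsTestFun a b η → ∫ t in Set.Ioo a b, v t * deriv η t = 0 := by
    intro η hη
    obtain ⟨Φ, hΦ, hd⟩ := reduce η hη
    have h0 := h Φ hΦ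
    have hdd : ∀ t, deriv (deriv Φ) t = deriv η t - (∫ s in a..b, η s) * deriv ψ t := by
      intro t
      rw [hd]
      exact ((hη.hasDerivAt t).sub ((hψ.hasDerivAt t).const_mul _)).deriv
    have e1 : ∀ t, u t * deriv (deriv Φ) t =
        u t * deriv η t - (∫ s in a..b, η s) * (u t * deriv ψ t) := fun t => by
      rw [hdd]
      ring
    simp only [e1] at h0
    rw [integral_sub (hη.deriv.integrableOn_mul (hloc hu))
      ((hψ.deriv.integrableOn_mul (hloc hu)).const_mul _), integral_const_mul, ← hκ] at h0
    have e2 : ∀ t, v t * deriv η t = u t * deriv η t + κ * (t * deriv η t) := fun t => by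
      simp only [hv]
      ring
    have e3 : ∫ t in Set.Ioo a b, t * deriv η t = -∫ s in a..b, η s := by
      rw [← intervalIntegral_eq_integral_Ioo hab.le,
        intervalIntegral.integral_mul_deriv_eq_deriv_mul (fun t _ => hasDerivAt_id' t)
          (fun t _ => hη.hasDerivAt t) (by simp)
          (hη.deriv.continuous.intervalIntegrable _ _), hη.left_eq_zero, hη.right_eq_zero]
      simp
    simp only [e2]
    rw [integral_add (hη.deriv.integrableOn_mul (hloc hu))
      ((hη.deriv.integrableOn_mul (hloc (continuousOn_id' _))).const_mul _), integral_const_mul, e3]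
    linarith
  set c := ∫ t in Set.Ioo a b, v t * ψ t with hc
  have hae : v =ᵐ[volume.restrict (Set.Ioo a b)] fun _ => c := by
    refine ae_eq_of_integral_mul_isTestFun (hloc hvc) (hloc continuousOn_const) fun η hη => ?_
    obtain ⟨Φ, hΦ, hd⟩ := reduce η hη
    have h0 := hv0 Φ hΦ
    have e1 : ∀ t, v t * deriv Φ t = v t * η t - (∫ s in a..b, η s) * (v t * ψ t) := fun t => by
      rw [hd]
      ring
    simp only [e1] at h0
    rw [integral_sub (hη.integrableOn_mul (hloc hvc))
      ((hψ.integrableOn_mul (hloc hvc)).const_mul _), integral_const_mul, ← hc] at h0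
    rw [integral_const_mul, ← intervalIntegral_eq_integral_Ioo hab.le η]
    linarith
  -- Continuity turns almost everywhere equality into equality on the open interval, then on its
  -- closure.
  have heq : Set.EqOn v (fun _ => c) (Set.Ioo a b) :=
    Measure.eqOn_open_of_ae_eq hae isOpen_Ioo (hvc.mono Set.Ioo_subset_Icc_self)
      continuousOn_const
  have heq' : Set.EqOn v (fun _ => c) (Set.Icc a b) :=
    heq.of_subset_closure hvc continuousOn_const Set.Ioo_subset_Icc_self
      (closure_Ioo hab.ne).ge
  refine ⟨c, -κ, fun t ht => ?_⟩
  have := heq' ht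
  simp only [hv] at this
  linarith

/-! ### Double primitives of integrable functions -/

/-- The primitive of `g` on `(a, b)` that vanishes at `a`. -/
def primitive (a b : ℝ) (g : ℝ → ℝ) (x : ℝ) : ℝ :=
  ∫ t in Set.Ioo a b, (if t < x then 1 else 0) * g t

/-- The double primitive of `g` on `(a, b)` that vanishes to second order at `a`. -/
def doublePrimitive (a b : ℝ) (g : ℝ → ℝ) (x : ℝ) : ℝ :=
  ∫ t in Set.Ioo a b, max (x - t) 0 * g t

theorem integral_ite_lt_mul {a b t : ℝ} (ht : t ∈ Set.Ioo a b) (F : ℝ → ℝ) :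
    ∫ x in Set.Ioo a b, (if t < x then 1 else 0) * F x = ∫ x in t..b, F x := by
  have e : ∀ x, (if t < x then (1 : ℝ) else 0) * F x = (Set.Ioi t).indicator F x := fun x => by
    simp [Set.indicator_apply]
  simp only [e]
  rw [setIntegral_indicator measurableSet_Ioi, intervalIntegral_eq_integral_Ioo ht.2.le,
    Set.Ioo_inter_Ioi, max_eq_right ht.1.le]

theorem integral_max_mul {a b t : ℝ} (ht : t ∈ Set.Ioo a b) (F : ℝ → ℝ) :
    ∫ x in Set.Ioo a b, max (x - t) 0 * F x = ∫ x in t..b, (x - t) * F x := by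
  rw [← integral_ite_lt_mul ht]
  refine integral_congr_ae (Filter.Eventually.of_forall fun x => ?_)
  simp only
  split_ifs with h
  · rw [max_eq_left (sub_pos.2 h).le, one_mul]
  · rw [max_eq_right (sub_nonpos.2 (not_lt.1 h)), zero_mul, zero_mul]

theorem IsTestFun.integral_ite_lt_mul_deriv {a b t : ℝ} {φ : ℝ → ℝ} (h : IsTestFun a b φ)
    (ht : t ∈ Set.Ioo a b) :
    ∫ x in Set.Ioo a b, (if t < x then 1 else 0) * _root_.deriv φ x = -φ t := by
  rw [integral_ite_lt_mul ht, intervalIntegral.integral_eq_sub_of_hasDerivAt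
    (fun x _ => h.hasDerivAt x) (h.deriv.continuous.intervalIntegrable _ _), h.right_eq_zero]
  ring

theorem IsTestFun.integral_max_mul_deriv {a b t : ℝ} {φ : ℝ → ℝ} (h : IsTestFun a b φ)
    (ht : t ∈ Set.Ioo a b) :
    ∫ x in Set.Ioo a b, max (x - t) 0 * _root_.deriv φ x =
      -∫ x in Set.Ioo a b, (if t < x then 1 else 0) * φ x := by
  rw [integral_ite_lt_mul ht, integral_max_mul ht,
    intervalIntegral.integral_mul_deriv_eq_deriv_mul
      (fun x _ => (hasDerivAt_id' x).sub_const t) (fun x _ => h.hasDerivAt x) (by simp)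
      (h.deriv.continuous.intervalIntegrable _ _), h.right_eq_zero]
  simp

theorem IsTestFun.integral_max_mul_deriv_deriv {a b t : ℝ} {φ : ℝ → ℝ} (h : IsTestFun a b φ)
    (ht : t ∈ Set.Ioo a b) :
    ∫ x in Set.Ioo a b, max (x - t) 0 * _root_.deriv (_root_.deriv φ) x = φ t := by
  rw [h.deriv.integral_max_mul_deriv ht, h.integral_ite_lt_mul_deriv ht, neg_neg]

/-- Fubini for a bounded kernel. Since `primitive` and `doublePrimitive` integrate kernels over a
fixed interval, their weak derivatives reduce to one-variable integration by parts at fixed `t`. -/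
theorem integral_integral_kernel_mul {a b C : ℝ} {k : ℝ → ℝ → ℝ}
    (hk : Measurable (Function.uncurry k))
    (hC : ∀ x ∈ Set.Ioo a b, ∀ t ∈ Set.Ioo a b, |k x t| ≤ C) {g ψ : ℝ → ℝ}
    (hg : IntegrableOn g (Set.Ioo a b)) (hψ : IntegrableOn ψ (Set.Ioo a b)) :
    ∫ x in Set.Ioo a b, (∫ t in Set.Ioo a b, k x t * g t) * ψ x =
      ∫ t in Set.Ioo a b, g t * ∫ x in Set.Ioo a b, k x t * ψ x := by
  have hint : Integrable (Function.uncurry fun x t => k x t * (ψ x * g t))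
      ((volume.restrict (Set.Ioo a b)).prod (volume.restrict (Set.Ioo a b))) := by
    refine (Integrable.mul_prod (L := ℝ) hψ hg).bdd_mul (c := C) hk.aestronglyMeasurable ?_
    rw [Measure.prod_restrict, ae_restrict_iff' (measurableSet_Ioo.prod measurableSet_Ioo)]
    exact Filter.Eventually.of_forall fun p hp => hC p.1 hp.1 p.2 hp.2
  have := integral_integral_swap hint
  calc ∫ x in Set.Ioo a b, (∫ t in Set.Ioo a b, k x t * g t) * ψ x
      = ∫ x in Set.Ioo a b, ∫ t in Set.Ioo a b, k x t * (ψ x * g t) := by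
        refine integral_congr_ae (Filter.Eventually.of_forall fun x => ?_)
        simp only
        rw [← integral_mul_const]
        exact integral_congr_ae (Filter.Eventually.of_forall fun t => by simp only; ring)
    _ = ∫ t in Set.Ioo a b, ∫ x in Set.Ioo a b, k x t * (ψ x * g t) := this
    _ = _ := by
        refine integral_congr_ae (Filter.Eventually.of_forall fun t => ?_)
        simp only
        rw [← integral_const_mul]
        exact integral_congr_ae (Filter.Eventually.of_forall fun x => by simp only; ring)

theorem measurable_ite_lt : Measurable (Function.uncurry fun x t : ℝ =>
    if t < x then (1 : ℝ) else 0) :=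
  Measurable.ite (measurableSet_lt measurable_snd measurable_fst) measurable_const
    measurable_const

theorem measurable_max_sub : Measurable (Function.uncurry fun x t : ℝ => max (x - t) 0) :=
  (measurable_fst.sub measurable_snd).max measurable_const

theorem abs_max_sub_le {a b : ℝ} {x t : ℝ} (hx : x ∈ Set.Icc a b) (ht : t ∈ Set.Icc a b) :
    |max (x - t) 0| ≤ b - a := by
  rw [abs_of_nonneg (le_max_right _ _)]
  exact max_le (by linarith [hx.2, ht.1]) (by linarith [hx.1, hx.2])

theorem integrableOn_max_sub_mul {a b : ℝ} {g : ℝ → ℝ} (hg : IntegrableOn g (Set.Ioo a b))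
    {x : ℝ} (hx : x ∈ Set.Icc a b) :
    IntegrableOn (fun t => max (x - t) 0 * g t) (Set.Ioo a b) := by
  refine Integrable.bdd_mul (c := b - a) hg (by fun_prop) ?_
  rw [ae_restrict_iff' measurableSet_Ioo]
  exact Filter.Eventually.of_forall fun t ht => abs_max_sub_le hx (Set.Ioo_subset_Icc_self ht)

theorem continuousOn_doublePrimitive {a b : ℝ} {g : ℝ → ℝ} (hg : IntegrableOn g (Set.Ioo a b)) :
    ContinuousOn (doublePrimitive a b g) (Set.Icc a b) := by
  refine continuousOn_of_dominated (bound := fun t => (b - a) * |g t|)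
    (fun x hx => (integrableOn_max_sub_mul hg hx).aestronglyMeasurable) (fun x hx => ?_)
    (hg.abs.const_mul _) (Filter.Eventually.of_forall fun t => by fun_prop)
  rw [ae_restrict_iff' measurableSet_Ioo]
  refine Filter.Eventually.of_forall fun t ht => ?_
  rw [norm_mul, Real.norm_eq_abs, Real.norm_eq_abs]
  exact mul_le_mul_of_nonneg_right (abs_max_sub_le hx (Set.Ioo_subset_Icc_self ht))
    (abs_nonneg _)

theorem memLp_primitive {a b : ℝ} {g : ℝ → ℝ} (hg : IntegrableOn g (Set.Ioo a b)) :
    MemLp (primitive a b g) 2 (volume.restrict (Set.Ioo a b)) := by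
  have hm : AEStronglyMeasurable (primitive a b g) (volume.restrict (Set.Ioo a b)) := by
    have : AEStronglyMeasurable (fun p : ℝ × ℝ => (if p.2 < p.1 then (1 : ℝ) else 0) * g p.2)
        ((volume.restrict (Set.Ioo a b)).prod (volume.restrict (Set.Ioo a b))) :=
      measurable_ite_lt.aestronglyMeasurable.mul hg.aestronglyMeasurable.comp_snd
    exact this.integral_prod_right'
  refine MemLp.of_bound hm (∫ t in Set.Ioo a b, |g t|) (Filter.Eventually.of_forall fun x => ?_)
  refine norm_integral_le_of_norm_le hg.abs (Filter.Eventually.of_forall fun t => ?_)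
  rw [norm_mul, Real.norm_eq_abs, Real.norm_eq_abs]
  refine mul_le_of_le_one_left (abs_nonneg _) ?_
  split_ifs <;> simp

theorem locallyIntegrableOn_of_memLp {a b : ℝ} {g : ℝ → ℝ}
    (hg : MemLp g 2 (volume.restrict (Set.Ioo a b))) : LocallyIntegrableOn g (Set.Ioo a b) :=
  IntegrableOn.locallyIntegrableOn (hg.integrable one_le_two)

theorem isWeakDeriv_one_doublePrimitive {a b : ℝ} {g : ℝ → ℝ}
    (hg : IntegrableOn g (Set.Ioo a b)) :
    IsWeakDeriv a b 1 (doublePrimitive a b g) (primitive a b g) := by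
  refine ⟨((continuousOn_doublePrimitive hg).mono Set.Ioo_subset_Icc_self).locallyIntegrableOn
    measurableSet_Ioo, locallyIntegrableOn_of_memLp (memLp_primitive hg), fun φ h1 h2 h3 => ?_⟩
  have hφ : IsTestFun a b φ := ⟨h1, h2, h3⟩
  simp only [doublePrimitive, primitive, iteratedDeriv_one]
  rw [integral_integral_kernel_mul measurable_max_sub (fun x hx t ht =>
      abs_max_sub_le (Set.Ioo_subset_Icc_self hx) (Set.Ioo_subset_Icc_self ht)) hg
      hφ.deriv.integrableOn,
    integral_integral_kernel_mul measurable_ite_lt (C := 1)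
      (fun x _ t _ => by split_ifs <;> simp) hg hφ.integrableOn, pow_one, neg_one_mul,
    ← integral_neg]
  refine setIntegral_congr_fun measurableSet_Ioo fun t ht => ?_
  rw [hφ.integral_max_mul_deriv ht, mul_neg]

theorem isWeakDeriv_two_doublePrimitive {a b : ℝ} {g : ℝ → ℝ}
    (hg : IntegrableOn g (Set.Ioo a b)) :
    IsWeakDeriv a b 2 (doublePrimitive a b g) g := by
  refine ⟨((continuousOn_doublePrimitive hg).mono Set.Ioo_subset_Icc_self).locallyIntegrableOn
    measurableSet_Ioo, hg.locallyIntegrableOn, fun φ h1 h2 h3 => ?_⟩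
  have hφ : IsTestFun a b φ := ⟨h1, h2, h3⟩
  simp only [doublePrimitive, iteratedDeriv_succ, iteratedDeriv_zero]
  rw [integral_integral_kernel_mul measurable_max_sub (fun x hx t ht =>
      abs_max_sub_le (Set.Ioo_subset_Icc_self hx) (Set.Ioo_subset_Icc_self ht)) hg
      hφ.deriv.deriv.integrableOn, neg_one_sq, one_mul]
  refine setIntegral_congr_fun measurableSet_Ioo fun t ht => ?_
  rw [hφ.integral_max_mul_deriv_deriv ht]

theorem isWeakDeriv_one_of_hasDerivAt {a b : ℝ} (hab : a < b) {f f' : ℝ → ℝ}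
    (hf : ∀ t, HasDerivAt f (f' t) t) (hf' : Continuous f') : IsWeakDeriv a b 1 f f' := by
  have hc : Continuous f := continuous_iff_continuousAt.2 fun t => (hf t).continuousAt
  refine ⟨hc.locallyIntegrable.locallyIntegrableOn _, hf'.locallyIntegrable.locallyIntegrableOn _,
    fun φ h1 h2 h3 => ?_⟩
  have hφ : IsTestFun a b φ := ⟨h1, h2, h3⟩
  rw [iteratedDeriv_one, ← intervalIntegral_eq_integral_Ioo hab.le,
    ← intervalIntegral_eq_integral_Ioo hab.le,
    intervalIntegral.integral_mul_deriv_eq_deriv_mul (fun t _ => hf t)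
      (fun t _ => hφ.hasDerivAt t) (hf'.intervalIntegrable _ _)
      (hφ.deriv.continuous.intervalIntegrable _ _), hφ.left_eq_zero, hφ.right_eq_zero]
  ring

theorem IsWeakDeriv.comp_one {a b : ℝ} {f f' f'' : ℝ → ℝ} (h : IsWeakDeriv a b 1 f f')
    (h' : IsWeakDeriv a b 1 f' f'') : IsWeakDeriv a b 2 f f'' := by
  refine ⟨h.1, h'.2.1, fun φ h1 h2 h3 => ?_⟩
  have hφ : IsTestFun a b φ := ⟨h1, h2, h3⟩
  have e1 := h.2.2 _ hφ.deriv.1 hφ.deriv.2.1 hφ.deriv.2.2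
  have e2 := h'.2.2 φ h1 h2 h3
  rw [iteratedDeriv_one] at e1 e2
  simp only [iteratedDeriv_succ, iteratedDeriv_zero]
  rw [e1, e2]
  ring

theorem isWeakDeriv_zero {a b : ℝ} {f : ℝ → ℝ} (hf : LocallyIntegrableOn f (Set.Ioo a b)) :
    IsWeakDeriv a b 0 f f :=
  ⟨hf, hf, fun φ _ _ _ => by simp⟩

theorem isWeakDeriv_two_affine_add_doublePrimitive {a b : ℝ} (hab : a < b) (c₀ c₁ : ℝ)
    {g : ℝ → ℝ} (hg : IntegrableOn g (Set.Ioo a b)) :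
    IsWeakDeriv a b 2 (fun t => c₀ + c₁ * t + doublePrimitive a b g t) g := by
  have h1 : IsWeakDeriv a b 1 (fun t => c₀ + c₁ * t) fun _ => c₁ :=
    isWeakDeriv_one_of_hasDerivAt hab (fun t => by
      simpa using ((hasDerivAt_id' t).const_mul c₁).const_add c₀) continuous_const
  have h2 : IsWeakDeriv a b 1 (fun _ => c₁) fun _ => 0 :=
    isWeakDeriv_one_of_hasDerivAt hab (fun t => hasDerivAt_const t c₁) continuous_const
  simpa using (h1.comp_one h2).add_const_mul (isWeakDeriv_two_doublePrimitive hg) 1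

theorem memSobolev_affine_add_doublePrimitive {a b : ℝ} (hab : a < b) (c₀ c₁ : ℝ) {g : ℝ → ℝ}
    (hg : MemLp g 2 (volume.restrict (Set.Ioo a b))) :
    MemSobolev a b 2 fun t => c₀ + c₁ * t + doublePrimitive a b g t := by
  have hg1 : IntegrableOn g (Set.Ioo a b) := hg.integrable one_le_two
  have hc : ContinuousOn (fun t => c₀ + c₁ * t + doublePrimitive a b g t) (Set.Icc a b) :=
    ContinuousOn.add (by fun_prop) (continuousOn_doublePrimitive hg1)
  refine ⟨hc, fun k hk => ?_⟩
  interval_cases k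
  · refine ⟨_, isWeakDeriv_zero
      ((hc.mono Set.Ioo_subset_Icc_self).locallyIntegrableOn measurableSet_Ioo), ?_⟩
    obtain ⟨C, hC⟩ := isCompact_Icc.exists_bound_of_continuousOn hc
    refine MemLp.of_bound ((hc.mono Set.Ioo_subset_Icc_self).aestronglyMeasurable
      measurableSet_Ioo) C ?_
    rw [ae_restrict_iff' measurableSet_Ioo]
    exact Filter.Eventually.of_forall fun t ht => hC t (Set.Ioo_subset_Icc_self ht)
  · have h1 : IsWeakDeriv a b 1 (fun t => c₀ + c₁ * t) fun _ => c₁ :=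
      isWeakDeriv_one_of_hasDerivAt hab (fun t => by
        simpa using ((hasDerivAt_id' t).const_mul c₁).const_add c₀) continuous_const
    refine ⟨fun t => c₁ + primitive a b g t, ?_, (memLp_const c₁).add (memLp_primitive hg1)⟩
    simpa using h1.add_const_mul (isWeakDeriv_one_doublePrimitive hg1) 1
  · exact ⟨g, isWeakDeriv_two_affine_add_doublePrimitive hab c₀ c₁ hg1, hg⟩

/-- Functions with integrable second weak derivative `g` are double primitives of `g` up to an
affine function. -/
theorem IsWeakDeriv.exists_eq_affine_add_doublePrimitive {a b : ℝ} (hab : a < b) {f g : ℝ → ℝ}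
    (hf : ContinuousOn f (Set.Icc a b)) (h : IsWeakDeriv a b 2 f g)
    (hg : IntegrableOn g (Set.Ioo a b)) :
    ∃ c₀ c₁, ∀ t ∈ Set.Icc a b, f t = c₀ + c₁ * t + doublePrimitive a b g t := by
  -- The difference of `f` and the double primitive has second weak derivative `g - g = 0`, so it is
  -- affine.
  have hw := h.add_const_mul (isWeakDeriv_two_doublePrimitive hg) (-1)
  obtain ⟨c₀, c₁, hc⟩ := exists_affine_of_integral_mul_deriv_deriv_eq_zero hab
    (u := fun t => f t + -1 * doublePrimitive a b g t)
    (hf.add ((continuousOn_doublePrimitive hg).const_mul _)) fun φ hφ => by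
      have := hw.2.2 φ hφ.1 hφ.2.1 hφ.2.2
      simpa [iteratedDeriv_succ, iteratedDeriv_zero] using this
  exact ⟨c₀, c₁, fun t ht => by linarith [hc t ht]⟩

/-! ### Hat functions -/

/-- The piecewise linear function with value `1` at `q` and support `[p, r]`. -/
def hat (p q r t : ℝ) : ℝ :=
  (max (r - t) 0 - max (q - t) 0) / (r - q) - (max (q - t) 0 - max (p - t) 0) / (q - p)

theorem continuous_hat (p q r : ℝ) : Continuous (hat p q r) := by
  unfold hat
  fun_prop

/-- In its nodes, `hat` is the slope difference of `s ↦ max (s - t) 0`, and integrating that kernel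
against `g` gives `doublePrimitive`; slope differences commute with the integral. -/
theorem integral_hat_mul {a b : ℝ} {g : ℝ → ℝ} (hg : IntegrableOn g (Set.Ioo a b)) {p q r : ℝ}
    (hp : p ∈ Set.Icc a b) (hq : q ∈ Set.Icc a b) (hr : r ∈ Set.Icc a b) :
    ∫ t in Set.Ioo a b, hat p q r t * g t =
      (doublePrimitive a b g r - doublePrimitive a b g q) / (r - q) -
        (doublePrimitive a b g q - doublePrimitive a b g p) / (q - p) := by
  have ip := integrableOn_max_sub_mul hg hp
  have iq := integrableOn_max_sub_mul hg hq
  have ir := integrableOn_max_sub_mul hg hr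
  have e : ∀ t, hat p q r t * g t =
      (max (r - t) 0 * g t - max (q - t) 0 * g t) / (r - q) -
        (max (q - t) 0 * g t - max (p - t) 0 * g t) / (q - p) := fun t => by
    simp only [hat]
    ring
  simp only [e, doublePrimitive]
  have irq : IntegrableOn (fun t => max (r - t) 0 * g t - max (q - t) 0 * g t) (Set.Ioo a b) :=
    ir.sub iq
  have iqp : IntegrableOn (fun t => max (q - t) 0 * g t - max (p - t) 0 * g t) (Set.Ioo a b) :=
    iq.sub ip
  rw [integral_sub (irq.div_const _) (iqp.div_const _), integral_div,
    integral_div, integral_sub ir iq, integral_sub iq ip]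

theorem integrableOn_Ioo_of_continuous {a b : ℝ} {g : ℝ → ℝ} (hg : Continuous g) :
    IntegrableOn g (Set.Ioo a b) :=
  (hg.continuousOn.integrableOn_compact isCompact_Icc).mono_set Set.Ioo_subset_Icc_self

/-- This is the `L²` inner product of two truncated linear functions. All Gram entries follow from
it, because `hat` is a combination of three of them. -/
theorem doublePrimitive_max_sub {a b p q : ℝ} (hp : a ≤ p) (hpq : p ≤ q) (hq : q ≤ b) :
    doublePrimitive a b (fun t => max (q - t) 0) p =
      (p - a) ^ 3 / 3 + (q - p) * (p - a) ^ 2 / 2 := by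
  have hc : Continuous fun t => max (p - t) 0 * max (q - t) 0 := by fun_prop
  have h0 : ∫ t in p..b, max (p - t) 0 * max (q - t) 0 = 0 := by
    refine intervalIntegral.integral_zero_ae (Filter.Eventually.of_forall fun t ht => ?_)
    rw [Set.uIoc_of_le (hpq.trans hq)] at ht
    rw [max_eq_right (by linarith [ht.1]), zero_mul]
  have h1 : ∫ t in a..p, max (p - t) 0 * max (q - t) 0 =
      ∫ t in a..p, (p - t) * (q - t) := by
    refine intervalIntegral.integral_congr fun t ht => ?_
    rw [Set.uIcc_of_le hp] at ht
    rw [max_eq_left (by linarith [ht.2]), max_eq_left (by linarith [ht.2])]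
  -- The antiderivative comes from `q - t = (p - t) + (q - p)`.
  have h2 : ∀ t, HasDerivAt (fun t => -((p - t) ^ 3 / 3) - (q - p) * (p - t) ^ 2 / 2)
      ((p - t) * (q - t)) t := by
    intro t
    have hd : HasDerivAt (fun t => p - t) (-1) t := (hasDerivAt_id' t).const_sub p
    refine (((hd.pow 3).div_const 3).neg.sub
      (((hd.pow 2).const_mul (q - p)).div_const 2)).congr_deriv ?_
    push_cast
    ring
  rw [doublePrimitive, ← intervalIntegral_eq_integral_Ioo (hp.trans (hpq.trans hq)),
    ← intervalIntegral.integral_add_adjacent_intervals (hc.intervalIntegrable a p)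
      (hc.intervalIntegrable p b), h0, h1, intervalIntegral.integral_eq_sub_of_hasDerivAt
      (fun t _ => h2 t) ((by fun_prop : Continuous fun t => (p - t) * (q - t)).intervalIntegrable
        _ _)]
  ring

theorem doublePrimitive_max_sub_comm (a b p q : ℝ) :
    doublePrimitive a b (fun t => max (q - t) 0) p =
      doublePrimitive a b (fun t => max (p - t) 0) q :=
  integral_congr_ae (Filter.Eventually.of_forall fun _ => mul_comm _ _)

theorem doublePrimitive_hat {a b p q r s : ℝ} (hp : p ∈ Set.Icc a b) (hq : q ∈ Set.Icc a b)
    (hr : r ∈ Set.Icc a b) :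
    doublePrimitive a b (hat p q r) s =
      (doublePrimitive a b (fun t => max (r - t) 0) s -
        doublePrimitive a b (fun t => max (q - t) 0) s) / (r - q) -
      (doublePrimitive a b (fun t => max (q - t) 0) s -
        doublePrimitive a b (fun t => max (p - t) 0) s) / (q - p) := by
  have hs := integral_hat_mul (integrableOn_Ioo_of_continuous (g := fun t => max (s - t) 0)
    (by fun_prop)) hp hq hr
  rw [doublePrimitive_max_sub_comm a b s r, doublePrimitive_max_sub_comm a b s q,
    doublePrimitive_max_sub_comm a b s p, ← hs]
  exact integral_congr_ae (Filter.Eventually.of_forall fun _ => mul_comm _ _)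

theorem integral_hat_mul_self {a b p q r : ℝ} (hp : a ≤ p) (hpq : p < q) (hqr : q < r)
    (hr : r ≤ b) : ∫ t in Set.Ioo a b, hat p q r t * hat p q r t = (r - p) / 3 := by
  have mp : p ∈ Set.Icc a b := ⟨hp, by linarith⟩
  have mq : q ∈ Set.Icc a b := ⟨by linarith, by linarith⟩
  have mr : r ∈ Set.Icc a b := ⟨by linarith, hr⟩
  rw [integral_hat_mul (integrableOn_Ioo_of_continuous (continuous_hat p q r)) mp mq mr]
  simp only [doublePrimitive_hat mp mq mr]
  -- The closed formula requires the evaluation point to be the smaller node, so symmetry first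
  -- reorders the mixed terms.
  rw [doublePrimitive_max_sub_comm a b r q, doublePrimitive_max_sub_comm a b r p,
    doublePrimitive_max_sub_comm a b q p,
    doublePrimitive_max_sub mr.1 le_rfl mr.2, doublePrimitive_max_sub mq.1 le_rfl mq.2,
    doublePrimitive_max_sub mp.1 le_rfl mp.2,
    doublePrimitive_max_sub mq.1 hqr.le mr.2, doublePrimitive_max_sub mp.1 hpq.le mq.2,
    doublePrimitive_max_sub mp.1 (hpq.trans hqr).le mr.2]
  have h1 : r - q ≠ 0 := (sub_pos.2 hqr).ne'
  have h2 : q - p ≠ 0 := (sub_pos.2 hpq).ne'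
  field_simp
  ring

theorem integral_hat_mul_hat_succ {a b p q r s : ℝ} (hp : a ≤ p) (hpq : p < q) (hqr : q < r)
    (hrs : r < s) (hs : s ≤ b) :
    ∫ t in Set.Ioo a b, hat p q r t * hat q r s t = (r - q) / 6 := by
  have mp : p ∈ Set.Icc a b := ⟨hp, by linarith⟩
  have mq : q ∈ Set.Icc a b := ⟨by linarith, by linarith⟩
  have mr : r ∈ Set.Icc a b := ⟨by linarith, by linarith⟩
  have ms : s ∈ Set.Icc a b := ⟨by linarith, hs⟩
  rw [integral_hat_mul (integrableOn_Ioo_of_continuous (continuous_hat q r s)) mp mq mr]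
  simp only [doublePrimitive_hat mq mr ms]
  rw [doublePrimitive_max_sub_comm a b r q,
    doublePrimitive_max_sub mr.1 le_rfl mr.2, doublePrimitive_max_sub mq.1 le_rfl mq.2,
    doublePrimitive_max_sub mr.1 hrs.le ms.2, doublePrimitive_max_sub mq.1 hqr.le mr.2,
    doublePrimitive_max_sub mq.1 (hqr.trans hrs).le ms.2,
    doublePrimitive_max_sub mp.1 (hpq.trans (hqr.trans hrs)).le ms.2,
    doublePrimitive_max_sub mp.1 (hpq.trans hqr).le mr.2,
    doublePrimitive_max_sub mp.1 hpq.le mq.2]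
  have h1 : r - q ≠ 0 := (sub_pos.2 hqr).ne'
  have h2 : q - p ≠ 0 := (sub_pos.2 hpq).ne'
  have h3 : s - r ≠ 0 := (sub_pos.2 hrs).ne'
  field_simp
  ring

/-- The supports meet in at most one point. Equivalently, as used here, the double primitive of the
right-hand hat vanishes up to `p'`, hence at all nodes of the left-hand one. -/
theorem integral_hat_mul_hat_eq_zero {a b p q r p' q' r' : ℝ} (hp : a ≤ p) (hpq : p < q)
    (hqr : q < r) (hrp : r ≤ p') (hpq' : p' < q') (hqr' : q' < r') (hr : r' ≤ b) :
    ∫ t in Set.Ioo a b, hat p q r t * hat p' q' r' t = 0 := by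
  have mp : p ∈ Set.Icc a b := ⟨hp, by linarith⟩
  have mq : q ∈ Set.Icc a b := ⟨by linarith, by linarith⟩
  have mr : r ∈ Set.Icc a b := ⟨by linarith, by linarith⟩
  have mp' : p' ∈ Set.Icc a b := ⟨by linarith, by linarith⟩
  have mq' : q' ∈ Set.Icc a b := ⟨by linarith, by linarith⟩
  have mr' : r' ∈ Set.Icc a b := ⟨by linarith, hr⟩
  have h1 : r' - q' ≠ 0 := (sub_pos.2 hqr').ne'
  have h2 : q' - p' ≠ 0 := (sub_pos.2 hpq').ne'
  have hz : ∀ s, a ≤ s → s ≤ p' → doublePrimitive a b (hat p' q' r') s = 0 := by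
    intro s hs hsp
    rw [doublePrimitive_hat mp' mq' mr', doublePrimitive_max_sub hs hsp mp'.2,
      doublePrimitive_max_sub hs (hsp.trans hpq'.le) mq'.2,
      doublePrimitive_max_sub hs (hsp.trans (hpq'.trans hqr').le) mr'.2]
    field_simp
    ring
  rw [integral_hat_mul (integrableOn_Ioo_of_continuous (continuous_hat p' q' r')) mp mq mr,
    hz p mp.1 (by linarith), hz q mq.1 (by linarith), hz r mr.1 hrp]
  simp

/-- The hat function at the `i`-th interior design point. -/
def hatAt {n : ℕ} (x : Fin n → ℝ) (i : Fin (n - 2)) : ℝ → ℝ :=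
  hat (x ⟨i, by omega⟩) (x ⟨i + 1, by omega⟩) (x ⟨i + 2, by omega⟩)

theorem integral_hatAt_mul_hatAt {n : ℕ} {x : Fin n → ℝ} (hx : StrictMono x) {a b : ℝ}
    (hab : ∀ i, x i ∈ Set.Icc a b) (i j : Fin (n - 2)) :
    ∫ t in Set.Ioo a b, hatAt x i t * hatAt x j t = hatGram x i j := by
  have hlt : ∀ {p q : ℕ} (hp : p < n) (hq : q < n), p < q → x ⟨p, hp⟩ < x ⟨q, hq⟩ :=
    fun hp hq hpq => hx (Fin.mk_lt_mk.2 hpq)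
  have key : ∀ i j : Fin (n - 2), (i : ℕ) ≤ j →
      ∫ t in Set.Ioo a b, hatAt x i t * hatAt x j t = hatGram x i j := by
    intro i j hij
    obtain ⟨i, hi⟩ := i
    obtain ⟨j, hj⟩ := j
    simp only at hij
    rcases hij.eq_or_lt with rfl | hij
    · simp only [hatAt, hatGram, Matrix.of_apply, if_true]
      exact integral_hat_mul_self (hab _).1 (hlt _ _ (by omega)) (hlt _ _ (by omega)) (hab _).2
    · rcases (Nat.succ_le_of_lt hij).eq_or_lt with rfl | hij'
      · have e : hatGram x ⟨i, hi⟩ ⟨i.succ, hj⟩ =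
            (x ⟨i + 2, by omega⟩ - x ⟨i + 1, by omega⟩) / 6 := by
          simp only [hatGram, Matrix.of_apply]
          rw [if_neg (by simp), if_neg (by simp; omega), if_pos (by simp)]
        rw [e]
        exact integral_hat_mul_hat_succ (hab _).1 (hlt _ _ (by simp)) (hlt _ _ (by simp))
          (hlt _ _ (by simp)) (hab _).2
      · have e : hatGram x ⟨i, hi⟩ ⟨j, hj⟩ = 0 := by
          simp only [hatGram, Matrix.of_apply]
          rw [if_neg hij.ne, if_neg (by omega), if_neg hij'.ne']
        rw [e]
        exact integral_hat_mul_hat_eq_zero (hab _).1 (hlt _ _ (by simp)) (hlt _ _ (by simp))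
          (hx.monotone (Fin.mk_le_mk.2 hij')) (hlt _ _ (by simp)) (hlt _ _ (by simp)) (hab _).2
  rcases le_total (i : ℕ) j with h | h
  · exact key i j h
  · rw [hatGram_symm, ← key j i h]
    exact integral_congr_ae (Filter.Eventually.of_forall fun _ => mul_comm _ _)

theorem continuous_hatAt {n : ℕ} (x : Fin n → ℝ) (i : Fin (n - 2)) : Continuous (hatAt x i) :=
  continuous_hat _ _ _

theorem continuous_sum_hatAt {n : ℕ} (x : Fin n → ℝ) (z : Fin (n - 2) → ℝ) :
    Continuous fun t => ∑ j, z j * hatAt x j t :=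
  continuous_finsetSum _ fun j _ => continuous_const.mul (continuous_hatAt x j)

theorem integral_hatAt_mul_sum {n : ℕ} {x : Fin n → ℝ} (hx : StrictMono x) {a b : ℝ}
    (hab : ∀ i, x i ∈ Set.Icc a b) (z : Fin (n - 2) → ℝ) (i : Fin (n - 2)) :
    ∫ t in Set.Ioo a b, hatAt x i t * ∑ j, z j * hatAt x j t = ∑ j, hatGram x i j * z j := by
  have e : ∀ t, hatAt x i t * ∑ j, z j * hatAt x j t =
      ∑ j, (hatAt x i t * hatAt x j t) * z j := fun t => by
    rw [Finset.mul_sum]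
    exact Finset.sum_congr rfl fun j _ => by ring
  simp only [e]
  have hI : ∀ j, IntegrableOn (fun t => hatAt x i t * hatAt x j t) (Set.Ioo a b) := fun j =>
    integrableOn_Ioo_of_continuous ((continuous_hatAt x i).mul (continuous_hatAt x j))
  rw [integral_finsetSum _ fun j _ => (hI j).mul_const _]
  simp only [integral_mul_const, integral_hatAt_mul_hatAt hx hab]

theorem integral_sum_hatAt_mul {n : ℕ} {x : Fin n → ℝ} {a b : ℝ} (z : Fin (n - 2) → ℝ)
    {g : ℝ → ℝ} (hg : ∀ i, IntegrableOn (fun t => hatAt x i t * g t) (Set.Ioo a b)) :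
    ∫ t in Set.Ioo a b, (∑ i, z i * hatAt x i t) * g t =
      ∑ i, z i * ∫ t in Set.Ioo a b, hatAt x i t * g t := by
  simp only [Finset.sum_mul, mul_assoc]
  rw [integral_finsetSum _ fun i _ => (hg i).const_mul _]
  simp only [integral_const_mul]

theorem integral_sum_hatAt_sq {n : ℕ} {x : Fin n → ℝ} (hx : StrictMono x) {a b : ℝ}
    (hab : ∀ i, x i ∈ Set.Icc a b) (z : Fin (n - 2) → ℝ) :
    ∫ t in Set.Ioo a b, (∑ i, z i * hatAt x i t) ^ 2 =
      ∑ i, ∑ j, hatGram x i j * (z i * z j) := by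
  simp only [sq]
  rw [integral_sum_hatAt_mul z fun i => integrableOn_Ioo_of_continuous
    ((continuous_hatAt x i).mul (continuous_sum_hatAt x z))]
  refine Finset.sum_congr rfl fun i _ => ?_
  rw [integral_hatAt_mul_sum hx hab, Finset.mul_sum]
  exact Finset.sum_congr rfl fun j _ => by ring

/-! ### Energy of Sobolev functions and their design values -/

theorem memLp_of_continuous {a b : ℝ} {g : ℝ → ℝ} (hg : Continuous g) :
    MemLp g 2 (volume.restrict (Set.Ioo a b)) := by
  obtain ⟨C, hC⟩ := isCompact_Icc.exists_bound_of_continuousOn (hg.continuousOn (s := Set.Icc a b))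
  refine MemLp.of_bound hg.aestronglyMeasurable C ?_
  rw [ae_restrict_iff' measurableSet_Ioo]
  exact Filter.Eventually.of_forall fun t ht => hC t (Set.Ioo_subset_Icc_self ht)

theorem integrableOn_mul_of_memLp {a b : ℝ} {g h : ℝ → ℝ}
    (hg : MemLp g 2 (volume.restrict (Set.Ioo a b)))
    (hh : MemLp h 2 (volume.restrict (Set.Ioo a b))) :
    IntegrableOn (fun t => g t * h t) (Set.Ioo a b) :=
  hg.integrable_mul hh

theorem integral_add_const_mul_sq {a b : ℝ} {g h : ℝ → ℝ}
    (hg : MemLp g 2 (volume.restrict (Set.Ioo a b)))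
    (hh : MemLp h 2 (volume.restrict (Set.Ioo a b))) (c : ℝ) :
    ∫ t in Set.Ioo a b, (g t + c * h t) ^ 2 = (∫ t in Set.Ioo a b, g t ^ 2) +
      2 * c * (∫ t in Set.Ioo a b, g t * h t) + c ^ 2 * ∫ t in Set.Ioo a b, h t ^ 2 := by
  have hgg : IntegrableOn (fun t => g t ^ 2) (Set.Ioo a b) := hg.integrable_sq
  have hhh : IntegrableOn (fun t => c ^ 2 * h t ^ 2) (Set.Ioo a b) :=
    hh.integrable_sq.const_mul _
  have hgh : IntegrableOn (fun t => 2 * c * (g t * h t)) (Set.Ioo a b) :=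
    (integrableOn_mul_of_memLp hg hh).const_mul _
  have hs : IntegrableOn (fun t => g t ^ 2 + 2 * c * (g t * h t)) (Set.Ioo a b) := hgg.add hgh
  have e : ∀ t, (g t + c * h t) ^ 2 = g t ^ 2 + 2 * c * (g t * h t) + c ^ 2 * h t ^ 2 :=
    fun t => by ring
  simp only [e]
  rw [integral_add hs hhh, integral_add hgg hgh, integral_const_mul, integral_const_mul]

/-- Slope differences of a double primitive are integrals against hat functions. -/
theorem slopeDiff_eq_integral_hatAt_mul {n : ℕ} {x : Fin n → ℝ} (hx : StrictMono x) {a b : ℝ}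
    (hab : ∀ i, x i ∈ Set.Icc a b) {f g : ℝ → ℝ} (hg : IntegrableOn g (Set.Ioo a b)) {c₀ c₁ : ℝ}
    (hf : ∀ t ∈ Set.Icc a b, f t = c₀ + c₁ * t + doublePrimitive a b g t) (i : Fin (n - 2)) :
    slopeDiff x (fun i => f (x i)) i = ∫ t in Set.Ioo a b, hatAt x i t * g t := by
  have h1 : x ⟨i + 2, by omega⟩ - x ⟨i + 1, by omega⟩ ≠ 0 :=
    (sub_pos.2 (hx (Fin.mk_lt_mk.2 (by omega)))).ne'
  have h2 : x ⟨i + 1, by omega⟩ - x ⟨i, by omega⟩ ≠ 0 :=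
    (sub_pos.2 (hx (Fin.mk_lt_mk.2 (by omega)))).ne'
  rw [hatAt, integral_hat_mul hg (hab _) (hab _) (hab _)]
  simp only [slopeDiff, hf _ (hab _)]
  field_simp
  ring

/-- Values with vanishing slope differences lie on a line. -/
theorem exists_affine_of_slopeDiff_eq_zero {n : ℕ} {x v : Fin n → ℝ} (hx : StrictMono x)
    (h : ∀ i, slopeDiff x v i = 0) : ∃ c₀ c₁, ∀ i, v i = c₀ + c₁ * x i := by
  rcases Nat.lt_or_ge n 2 with hn | hn
  · rcases Nat.eq_zero_or_pos n with rfl | hn0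
    · exact ⟨0, 0, fun i => i.elim0⟩
    · refine ⟨v ⟨0, hn0⟩, 0, fun i => ?_⟩
      have : i = ⟨0, hn0⟩ := Fin.ext (by simp only; omega)
      rw [this, zero_mul, add_zero]
  · have hne : ∀ k (hk : k + 1 < n), x ⟨k + 1, hk⟩ - x ⟨k, by omega⟩ ≠ 0 := fun k hk =>
      (sub_pos.2 (hx (Fin.mk_lt_mk.2 (by omega)))).ne'
    set c := (v ⟨1, by omega⟩ - v ⟨0, by omega⟩) / (x ⟨1, by omega⟩ - x ⟨0, by omega⟩) with hc
    have hs : ∀ k (hk : k + 1 < n),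
        (v ⟨k + 1, hk⟩ - v ⟨k, by omega⟩) / (x ⟨k + 1, hk⟩ - x ⟨k, by omega⟩) = c := by
      intro k
      induction k with
      | zero => exact fun _ => rfl
      | succ k ih =>
        intro hk
        rw [← ih (by omega)]
        exact sub_eq_zero.1 (h ⟨k, by omega⟩)
    have hv : ∀ k (hk : k < n), v ⟨k, hk⟩ =
        v ⟨0, by omega⟩ - c * x ⟨0, by omega⟩ + c * x ⟨k, hk⟩ := by
      intro k
      induction k with
      | zero =>
        intro _
        ring
      | succ k ih =>
        intro hk
        have h1 := (div_eq_iff (hne k hk)).1 (hs k hk)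
        linarith [ih (by omega)]
    exact ⟨v ⟨0, by omega⟩ - c * x ⟨0, by omega⟩, c, fun i => hv i i.2⟩

/-- The natural cubic spline that interpolates `θ`. -/
theorem exists_interpolant {n : ℕ} {x : Fin n → ℝ} (hx : StrictMono x) {a b : ℝ} (hlt : a < b)
    (hab : ∀ i, x i ∈ Set.Icc a b) (θ : Fin n → ℝ) :
    ∃ F h : ℝ → ℝ, MemSobolev a b 2 F ∧ IsWeakDeriv a b 2 F h ∧
      MemLp h 2 (volume.restrict (Set.Ioo a b)) ∧ (∀ i, F (x i) = θ i) ∧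
      ∫ t in Set.Ioo a b, h t ^ 2 =
        (discDeriv x 2).mulVec θ ⬝ᵥ (kMat x).mulVec ((discDeriv x 2).mulVec θ) := by
  set β := (discDeriv x 2).mulVec θ with hβ
  -- These coefficients solve `T z = W β`, which makes the slope differences of the double primitive
  -- of `h` equal those of `θ`.
  set z : Fin (n - 2) → ℝ := fun i => (kMat x).mulVec β i / weight x 2 i with hz
  set h : ℝ → ℝ := fun t => ∑ j, z j * hatAt x j t with hh
  have hL : MemLp h 2 (volume.restrict (Set.Ioo a b)) :=
    memLp_of_continuous (continuous_sum_hatAt x z)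
  have hI : IntegrableOn h (Set.Ioo a b) := hL.integrable one_le_two
  have hs : ∀ i, slopeDiff x (fun i => doublePrimitive a b h (x i)) i = slopeDiff x θ i := by
    intro i
    rw [slopeDiff_eq_integral_hatAt_mul hx hab hI (c₀ := 0) (c₁ := 0) (fun t _ => by simp),
      integral_hatAt_mul_sum hx hab, hatGram_mulVec_kMat hx, hβ, weight_mul_discDeriv_two hx]
  obtain ⟨c₀, c₁, hc⟩ := exists_affine_of_slopeDiff_eq_zero hx
    (v := fun i => θ i - doublePrimitive a b h (x i)) fun i => by
      have := hs i
      simp only [slopeDiff] at this ⊢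
      linear_combination -this
  refine ⟨_, h, memSobolev_affine_add_doublePrimitive hlt c₀ c₁ hL,
    isWeakDeriv_two_affine_add_doublePrimitive hlt c₀ c₁ hI, hL, fun i => ?_, ?_⟩
  · linarith [hc i]
  · rw [integral_sum_hatAt_sq hx hab, dotProduct_kMat_mulVec hx]

theorem sum_weight_discDeriv_sq_le_integral {n : ℕ} {x : Fin n → ℝ} (hx : StrictMono x)
    {a b : ℝ} (hlt : a < b) (hab : ∀ i, x i ∈ Set.Icc a b) {f g : ℝ → ℝ}
    (hf : ContinuousOn f (Set.Icc a b)) (hfg : IsWeakDeriv a b 2 f g)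
    (hg : MemLp g 2 (volume.restrict (Set.Ioo a b))) :
    ∑ i, weight x 2 i * (discDeriv x 2).mulVec (fun i => f (x i)) i ^ 2 ≤
      ∫ t in Set.Ioo a b, g t ^ 2 := by
  have hgI : IntegrableOn g (Set.Ioo a b) := hg.integrable one_le_two
  obtain ⟨c₀, c₁, hc⟩ := hfg.exists_eq_affine_add_doublePrimitive hlt hf hgI
  set β := (discDeriv x 2).mulVec (fun i => f (x i)) with hβ
  -- With the discrete derivative as coefficients, `∫ h g` is exactly the `W`-form of `β` and, by `T
  -- ≤ W`, `∫ h²` is at most that. Nonnegativity of `∫ (g - h)²` finishes.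
  set h : ℝ → ℝ := fun t => ∑ j, β j * hatAt x j t with hh
  have hL : MemLp h 2 (volume.restrict (Set.Ioo a b)) :=
    memLp_of_continuous (continuous_sum_hatAt x β)
  have h1 : ∫ t in Set.Ioo a b, h t * g t = ∑ i, weight x 2 i * β i ^ 2 := by
    rw [integral_sum_hatAt_mul β fun i => integrableOn_mul_of_memLp
      (memLp_of_continuous (continuous_hatAt x i)) hg]
    refine Finset.sum_congr rfl fun i _ => ?_
    rw [← slopeDiff_eq_integral_hatAt_mul hx hab hgI hc, ← weight_mul_discDeriv_two hx]
    ring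
  have h2 : ∫ t in Set.Ioo a b, h t ^ 2 ≤ ∑ i, weight x 2 i * β i ^ 2 := by
    have := hatGram_quadForm_le hx β
    rwa [← integral_sum_hatAt_sq hx hab] at this
  have h3 : 0 ≤ ∫ t in Set.Ioo a b, (g t - h t) ^ 2 := integral_nonneg fun t => sq_nonneg _
  have e := integral_add_const_mul_sq hg hL (-1)
  have e' : ∀ t, g t + -1 * h t = g t - h t := fun t => by ring
  simp only [e', mul_comm (g _)] at e
  rw [h1] at e
  linarith

/-! ### Comparison of the two minimizers -/

theorem nonneg_of_forall_linear_add_sq_nonneg {A B : ℝ} (h : ∀ t : ℝ, 0 ≤ A * t + B * t ^ 2) :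
    0 ≤ A := by
  by_contra! hA
  have hB : 0 < |B| + 1 := by positivity
  -- The minimizer of `A t + (|B| + 1) t²`; replacing `B` by `|B| + 1` ensures a positive leading
  -- coefficient.
  have h1 := h (-A / (2 * (|B| + 1)))
  have h2 : B * (-A / (2 * (|B| + 1))) ^ 2 ≤ (|B| + 1) * (-A / (2 * (|B| + 1))) ^ 2 :=
    mul_le_mul_of_nonneg_right (by linarith [le_abs_self B]) (sq_nonneg _)
  have h3 : A * (-A / (2 * (|B| + 1))) + (|B| + 1) * (-A / (2 * (|B| + 1))) ^ 2 =
      -(A ^ 2 / (4 * (|B| + 1))) := by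
    field_simp
    ring
  have h4 : 0 < A ^ 2 / (4 * (|B| + 1)) := div_pos (by nlinarith) (by linarith)
  linarith

theorem sum_sub_add_mul_sq {n : ℕ} (y u v : Fin n → ℝ) (c : ℝ) :
    ∑ i, (y i - (u i + c * v i)) ^ 2 = ∑ i, (y i - u i) ^ 2 -
      2 * c * ∑ i, (y i - u i) * v i + c ^ 2 * ∑ i, v i ^ 2 := by
  simp only [Finset.mul_sum, ← Finset.sum_add_distrib, ← Finset.sum_sub_distrib]
  exact Finset.sum_congr rfl fun i _ => by ring

/-- First-order condition for the smoothing spline, tested against `F - f`. -/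
theorem IsSmoothingSpline.sum_le {n : ℕ} {a b : ℝ} (hab : a < b) {x y : Fin n → ℝ} {lam : ℝ}
    (hlam : 0 ≤ lam) {f g F h : ℝ → ℝ} (hf : IsSmoothingSpline a b x y 2 lam f)
    (hg : IsWeakDeriv a b 2 f g) (hg2 : MemLp g 2 (volume.restrict (Set.Ioo a b)))
    (hF : MemSobolev a b 2 F) (hh : IsWeakDeriv a b 2 F h)
    (hh2 : MemLp h 2 (volume.restrict (Set.Ioo a b))) :
    ∑ i, (y i - f (x i)) * (F (x i) - f (x i)) ≤
      lam / 2 * ((∫ t in Set.Ioo a b, h t ^ 2) - ∫ t in Set.Ioo a b, g t ^ 2) := by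
  have hd2 : MemLp (fun t => h t + -1 * g t) 2 (volume.restrict (Set.Ioo a b)) :=
    hh2.add (hg2.const_mul _)
  set S := ∑ i, (y i - f (x i)) * (F (x i) - f (x i)) with hS
  set M := ∫ t in Set.Ioo a b, g t * (h t + -1 * g t) with hM
  set E := ∫ t in Set.Ioo a b, (h t + -1 * g t) ^ 2 with hE
  have key : ∀ c : ℝ, 0 ≤ (2 * lam * M - 2 * S) * c +
      (∑ i, (F (x i) - f (x i)) ^ 2 + lam * E) * c ^ 2 := by
    intro c
    have hmin := hf.2 _ (hf.1.add_const_mul (hF.add_const_mul hf.1 (-1)) c)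
    have hw := hg.add_const_mul (hh.add_const_mul hg (-1)) c
    simp only [splineObjective] at hmin
    rw [hg.integral_weakDeriv_sq hab, hw.integral_weakDeriv_sq hab,
      integral_add_const_mul_sq hg2 hd2 c,
      sum_sub_add_mul_sq y (fun i => f (x i)) (fun i => F (x i) + -1 * f (x i)) c] at hmin
    simp only [neg_one_mul, ← sub_eq_add_neg] at hmin hM hE ⊢
    rw [← hS, ← hM, ← hE] at hmin
    nlinarith [hmin]
  have h0 := nonneg_of_forall_linear_add_sq_nonneg key
  -- Stationarity gives `S ≤ lam * M`. Dropping `E` from `∫ h² = ∫ g² + 2M + E` bounds `M` by half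
  -- the energy difference.
  have hE0 : 0 ≤ E := integral_nonneg fun t => sq_nonneg _
  have hJ := integral_add_const_mul_sq hg2 hd2 1
  have e : ∀ t, g t + 1 * (h t + -1 * g t) = h t := fun t => by ring
  simp only [e] at hJ
  rw [← hM, ← hE] at hJ
  nlinarith [mul_nonneg hlam hE0]

/-- First-order condition for the weighted Bohlmann-Whittaker filter, tested against `η - θ`. -/
theorem IsWeightedBW.sum_le {n : ℕ} {x y : Fin n → ℝ} {lam : ℝ} {θ : Fin n → ℝ}
    (hθ : IsWeightedBW x y 2 lam θ) (η : Fin n → ℝ) :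
    ∑ i, (y i - θ i) * (η i - θ i) ≤
      lam * (∑ i, weight x 2 i *
          ((discDeriv x 2).mulVec θ i * (discDeriv x 2).mulVec η i) -
        ∑ i, weight x 2 i * (discDeriv x 2).mulVec θ i ^ 2) := by
  set D := discDeriv x 2 with hD
  set S := ∑ i, (y i - θ i) * (η i - θ i) with hS
  set P := ∑ i, weight x 2 i * (D.mulVec θ i * D.mulVec η i) with hP
  set Q := ∑ i, weight x 2 i * D.mulVec θ i ^ 2 with hQ
  have key : ∀ c : ℝ, 0 ≤ (2 * lam * (P - Q) - 2 * S) * c +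
      (∑ i, (η i - θ i) ^ 2 +
        lam * ∑ i, weight x 2 i * (D.mulVec η i - D.mulVec θ i) ^ 2) * c ^ 2 := by
    intro c
    have hmin := hθ fun i => θ i + c * (η i - θ i)
    simp only [bwObjective] at hmin
    rw [sum_sub_add_mul_sq y θ (fun i => η i - θ i) c, ← hS, ← hD] at hmin
    have hlin : ∀ i, D.mulVec (fun i => θ i + c * (η i - θ i)) i =
        D.mulVec θ i + c * (D.mulVec η i - D.mulVec θ i) := by
      intro i
      have : (fun i => θ i + c * (η i - θ i)) = θ + c • (η - θ) := rfl
      rw [this, Matrix.mulVec_add, Matrix.mulVec_smul, Matrix.mulVec_sub]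
      rfl
    have e0 : ∑ i, D.mulVec θ i ^ 2 * weight x 2 i = Q :=
      Finset.sum_congr rfl fun i _ => mul_comm _ _
    have e1 : ∑ i, D.mulVec (fun i => θ i + c * (η i - θ i)) i ^ 2 * weight x 2 i =
        Q + 2 * c * (P - Q) +
          c ^ 2 * ∑ i, weight x 2 i * (D.mulVec η i - D.mulVec θ i) ^ 2 := by
      rw [hP, hQ]
      simp only [hlin]
      simp only [mul_sub, Finset.mul_sum, ← Finset.sum_add_distrib, ← Finset.sum_sub_distrib]
      exact Finset.sum_congr rfl fun i _ => by ring
    rw [e0, e1] at hmin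
    nlinarith [hmin]
  linarith [nonneg_of_forall_linear_add_sq_nonneg key]

theorem sum_sq_sub_le {n : ℕ} {x : Fin n → ℝ} (hx : StrictMono x) {a b : ℝ} (hab : a < b)
    (hxab : ∀ i, x i ∈ Set.Icc a b) {y : Fin n → ℝ} {lamA lamB : ℝ} (hA : 0 ≤ lamA)
    (hAB : 3 * lamA ≤ lamB) {f : ℝ → ℝ} {θ : Fin n → ℝ}
    (hf : IsSmoothingSpline a b x y 2 lamA f) (hθ : IsWeightedBW x y 2 lamB θ) :
    ∑ i, (f (x i) - θ i) ^ 2 ≤ lamB / 3 * ∫ t in a..b, weakDeriv a b 2 f t ^ 2 := by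
  obtain ⟨g, hg, hg2⟩ := hf.1.2 2 le_rfl
  obtain ⟨F, h, hF, hh, hh2, hFx, hJ⟩ := exists_interpolant hx hab hxab θ
  rw [hg.integral_weakDeriv_sq hab]
  have h1 := hf.sum_le hab hA hg hg2 hF hh hh2
  have h2 := hθ.sum_le fun i => f (x i)
  have h3 := sum_weight_discDeriv_sq_le_integral hx hab hxab hf.1.1 hg hg2
  have h4 := ((spectrallySimilar_kMat hx).2.2.2.2.2 ((discDeriv x 2).mulVec θ)).2
  rw [← hJ, dotProduct_weightMat_mulVec] at h4
  set β := (discDeriv x 2).mulVec θ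
  set γ := (discDeriv x 2).mulVec fun i => f (x i)
  set I := ∫ t in Set.Ioo a b, g t ^ 2
  set J := ∫ t in Set.Ioo a b, h t ^ 2
  set P := ∑ i, weight x 2 i * (β i * γ i)
  set Q := ∑ i, weight x 2 i * β i ^ 2
  -- As `F` takes the values `θ`, the second factors are opposite and `y` cancels.
  have hsplit : ∑ i, (f (x i) - θ i) ^ 2 = ∑ i, (y i - θ i) * (f (x i) - θ i) +
      ∑ i, (y i - f (x i)) * (F (x i) - f (x i)) := by
    rw [← Finset.sum_add_distrib]
    exact Finset.sum_congr rfl fun i _ => by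
      rw [hFx]
      ring
  have hI : 0 ≤ I := integral_nonneg fun t => sq_nonneg _
  -- Cauchy-Schwarz with a free scale `s`, combined with the bound of the `W`-form of `γ` by `I`.
  have hCS : ∀ s : ℝ, 2 * s * P ≤ I + s ^ 2 * Q := by
    intro s
    have h0 : 0 ≤ ∑ i, weight x 2 i * (γ i - s * β i) ^ 2 :=
      Finset.sum_nonneg fun i _ => mul_nonneg (weight_pos hx two_pos i).le (sq_nonneg _)
    have e : ∑ i, weight x 2 i * (γ i - s * β i) ^ 2 =
        ∑ i, weight x 2 i * γ i ^ 2 - 2 * s * P + s ^ 2 * Q := by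
      simp only [P, Q, Finset.mul_sum, ← Finset.sum_add_distrib, ← Finset.sum_sub_distrib]
      exact Finset.sum_congr rfl fun i _ => by ring
    linarith
  have hbound : ∑ i, (f (x i) - θ i) ^ 2 ≤ lamB * (P - Q) + lamA / 2 * (3 * Q - I) := by
    rw [hsplit]
    nlinarith [mul_le_mul_of_nonneg_left h4 hA]
  refine hbound.trans ?_
  rcases (show 0 ≤ lamB by linarith).eq_or_lt with h0 | hpos
  · have : lamA = 0 := by linarith
    rw [← h0, this]
    simp
  · obtain ⟨r, rfl⟩ : ∃ r, lamA = r * lamB := ⟨lamA / lamB, by field_simp⟩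
    have hr0 : 0 ≤ r := nonneg_of_mul_nonneg_left hA hpos
    have hr1 : 3 * r ≤ 1 := le_of_mul_le_mul_right (by linarith) hpos
    have hs : 0 < 2 - 3 * r := by linarith
    -- The scale `s = 2 - 3r` is the one for which the total coefficient of `Q`, namely `s / 2 - 1 +
    -- 3r / 2`, vanishes.
    have hP : P ≤ I / (2 * (2 - 3 * r)) + (2 - 3 * r) / 2 * Q := by
      have := hCS (2 - 3 * r)
      rw [← mul_le_mul_iff_right₀ (show 0 < 2 * (2 - 3 * r) by linarith)]
      have e : 2 * (2 - 3 * r) * (I / (2 * (2 - 3 * r)) + (2 - 3 * r) / 2 * Q) =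
          I + (2 - 3 * r) ^ 2 * Q := by
        field_simp
      rw [e]
      exact this
    -- After clearing denominators this says `9 r² ≤ 1`, which follows from `0 ≤ r ≤ 1/3`; equality
    -- at `r = 1/3` is possible.
    have hc : I / (2 * (2 - 3 * r)) ≤ (1 / 3 + r / 2) * I := by
      rw [div_le_iff₀ (by linarith)]
      nlinarith [mul_nonneg hI (mul_nonneg hr0 (sub_nonneg.2 hr1))]
    have hfin : (P - Q) + r / 2 * (3 * Q - I) ≤ I / 3 := by nlinarith
    calc lamB * (P - Q) + r * lamB / 2 * (3 * Q - I)
        = lamB * ((P - Q) + r / 2 * (3 * Q - I)) := by ring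
      _ ≤ lamB * (I / 3) := mul_le_mul_of_nonneg_left hfin hpos.le
      _ = lamB / 3 * I := by ring

end SmoothingSpline

end

theorem theorem8p1 {n : ℕ} (x : Fin n → ℝ) (hx : StrictMono x) :
    IsUnit (SmoothingSpline.kInv x) ∧
    SmoothingSpline.SpectrallySimilar 3 1
      (SmoothingSpline.kMat x) (SmoothingSpline.weightMat x 2) ∧
    ∀ (a b : ℝ), a < b → (∀ i, x i ∈ Set.Icc a b) →
      ∀ (y : Fin n → ℝ) (lamA lamB : ℝ), 0 ≤ lamA → 3 * lamA ≤ lamB →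
        ∀ (f : ℝ → ℝ) (θ : Fin n → ℝ),
          SmoothingSpline.IsSmoothingSpline a b x y 2 lamA f →
          SmoothingSpline.IsWeightedBW x y 2 lamB θ →
            ∑ i, (f (x i) - θ i) ^ 2 ≤
              lamB / 3 * ∫ t in a..b, SmoothingSpline.weakDeriv a b 2 f t ^ 2 := by
  exact ⟨(SmoothingSpline.kInv_posDef hx).isUnit, SmoothingSpline.spectrallySimilar_kMat hx,
    fun a b hab hxab y lamA lamB hA hAB f θ hf hθ =>
      SmoothingSpline.sum_sq_sub_le hx hab hxab hA hAB hf hθ⟩
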